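/- Let $K$ be an ordered field in which every non-negative element is a square (for example $\mathbb R$, or a real closure of the field of rational functions in the symbols $\sqrt{\lambda_e}$), and let $\Lambda=\bigwedge V$ be the Grassmann algebra of a $K$-vector space $V$, with body map $\Lambda\to K$. An even element of $\Lambda$ with positive body has a unique even square root with positive body, denoted $\sqrt{\ }$. Let $T$ be a triangulation of an $n$-gon with an orientation of its arcs (sides and diagonals). To each arc $ij$ of $T$ let an even element $\lambda_{ij}=\lambda_{ji}\in\Lambda$ with positive body be assigned, and to each triangle $ijk$ of $T$ an odd element $\boxed{ijk}\in\Lambda$, independent of the order of its vertices. (For $K$ as in the second example, one may take independent $\lambda_{ij}$ and for $V$ the space with basis the $\boxed{ijk}$.) *Flips.* Let $i,j,k,\ell$ be the vertices, in counterclockwise order, of a quadrilateral made of two triangles $ijk$, $ik\ell$ with $\mu$-invariants $\sigma=\boxed{ijk}$, $\theta=\boxed{ik\ell}$ and diagonal oriented $i\to k$; write $a=\lambda_{i\ell}$, $b=\lambda_{k\ell}$, $c=\lambda_{jk}$, $d=\lambda_{ij}$, $e=\lambda_{ik}$. The flip replaces the diagonal $ik$ by $j\ell$, oriented $j\to\ell$,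 with $$e\,\lambda_{j\ell}=ac+bd+\sqrt{abcd}\,\sigma\theta,\qquad \boxed{jk\ell}=\frac{\sigma\sqrt{bd}-\theta\sqrt{ac}}{\sqrt{ac+bd}},\qquad \boxed{ij\ell}=\frac{\theta\sqrt{bd}+\sigma\sqrt{ac}}{\sqrt{ac+bd}};$$ it reverses the orientation of the side $k\ell$ and keeps everything else. For any two distinct vertices $i,j$ of the polygon, the super $\lambda$-length $\lambda_{ij}$ is the $\lambda$-length of the arc $ij$ in a triangulation containing it that is obtained from $T$ by a sequence of flips; set $\lambda_{ii}=0$. *The graph $\Gamma_T$.* Each triangle of $T$ contains a hexagon whose six vertices correspond to the pairs (vertex of the triangle, side at this vertex); its edges are alternately parallel to the sides of the triangle and located at its angles. For each internal diagonal, the two vertices of $\Gamma_T$ on opposite sides of the diagonal that lie by the same endpoint are joined by an edge, for each of the two endpoints. A vertex of $\Gamma_T$ is *near* the polygon vertex at whose angle it lies. *The connection.* Put $h^i_{jk}=\lambda_{jk}/(\lambda_{ij}\lambda_{ik})$ and $$E(x)=\begin{pmatrix}0&-x&0\\1/x&0&0\\0&0&1\end{pmatrix},\quad A(h|\theta)=\begin{pmatrix}1&0&0\\h&1&-\sqrt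 h\,\theta\\\sqrt h\,\theta&0&1\end{pmatrix},\quad \rho=\begin{pmatrix}-1&0&0\\0&-1&0\\0&0&1\end{pmatrix}.$$ Within a triangle $ijk$, the edge at the angle $i$, traversed clockwise around the hexagon, carries $A(h^i_{jk}|\boxed{ijk})$, and the edge parallel to $ij$, traversed clockwise, carries $E(\lambda_{ij})$; traversed counterclockwise they carry the inverse matrices. Of the two edges crossing a diagonal oriented $i\to j$, the one near $i$ carries the identity and the one near $j$ carries $\rho$, in both directions. The holonomy along a path is the product of the matrices of its edges, the first edge being the rightmost factor. **Theorem.** Let $i,j$ be vertices of the polygon, and let $i'$, $j'$ be any vertices of $\Gamma_T$ near $i$ and $j$ respectively. Then there is a path in $\Gamma_T$ from $i'$ to $j'$, and all such paths have the same holonomy $H$; the super $\lambda$-length $\lambda_{ij}$ exists and does not depend on the sequence of flips; and the $(1,2)$-entry of $H$ is $\lambda_{ij}$ or $-\lambda_{ij}$. -/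

import Mathlib

open scoped Matrix

/-! Combinatorics of a polygon whose vertices are `Fin n`, numbered counterclockwise. -/

/-- The vertices `i, j, k` of the polygon are distinct and in counterclockwise order. -/
def Ccw {n : ℕ} (i j k : Fin n) : Prop :=
  (i < j ∧ j < k) ∨ (j < k ∧ k < i) ∨ (k < i ∧ i < j)

/-- The chords `ab` and `cd` of the polygon cross in their interiors. -/
def Crosses {n : ℕ} (a b c d : Fin n) : Prop :=
  (Ccw a c b ∧ Ccw b d a) ∨ (Ccw a d b ∧ Ccw b c a)

/-- A triangulation of the `n`-gon: a maximal set of pairwise non-crossing arcs (sides and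
diagonals), seen as a graph on the vertices of the polygon. -/
structure PolygonTriangulation (n : ℕ) where
  /-- the graph of arcs, boundary sides included -/
  graph : SimpleGraph (Fin n)
  noncrossing : ∀ a b c d, graph.Adj a b → graph.Adj c d → ¬ Crosses a b c d
  maximal : ∀ a b, a ≠ b → (∀ c d, graph.Adj c d → ¬ Crosses a b c d) → graph.Adj a b

/-- `a, b, c` are the vertices of a triangle of the triangulation. -/
def PolygonTriangulation.IsTriangle {n : ℕ} (T : PolygonTriangulation n) (a b c : Fin n) : Prop :=
  T.graph.Adj a b ∧ T.graph.Adj a c ∧ T.graph.Adj b c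

/-- A vertex of the graph `Γ_T`: a corner of the hexagon drawn inside the triangle
`near, side, opp`, namely the one close to the vertex `near` and to the side `near-side`.
(The six orderings of the vertices of a triangle give the six corners.) -/
@[ext]
structure GammaVertex {n : ℕ} (T : PolygonTriangulation n) where
  near : Fin n
  side : Fin n
  opp : Fin n
  isTriangle : T.IsTriangle near side opp

namespace GammaVertex

variable {n : ℕ} {T : PolygonTriangulation n}

/-- `v` and `w` are joined by the hexagon edge at an angle of a triangle. -/
def AngleEdge (v w : GammaVertex T) : Prop :=
  w.near = v.near ∧ w.side = v.opp ∧ w.opp = v.side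

/-- `v` and `w` are joined by a hexagon edge parallel to a side of a triangle. -/
def ParallelEdge (v w : GammaVertex T) : Prop :=
  w.near = v.side ∧ w.side = v.near ∧ w.opp = v.opp

/-- `v` and `w` are joined by an edge that crosses an internal diagonal: they are the corners, near
the same endpoint of the diagonal, in the two triangles on its two sides. -/
def CrossingEdge (v w : GammaVertex T) : Prop :=
  w.near = v.near ∧ w.side = v.side ∧ w.opp ≠ v.opp

end GammaVertex

/-- The graph `Γ_T`. -/
def gammaGraph {n : ℕ} (T : PolygonTriangulation n) : SimpleGraph (GammaVertex T) where
  Adj v w := v.AngleEdge w ∨ v.ParallelEdge w ∨ v.CrossingEdge w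
  symm := ⟨by
    rintro v w (⟨h1, h2, h3⟩ | ⟨h1, h2, h3⟩ | ⟨h1, h2, h3⟩)
    · exact Or.inl ⟨h1.symm, h3.symm, h2.symm⟩
    · exact Or.inr (Or.inl ⟨h2.symm, h1.symm, h3.symm⟩)
    · exact Or.inr (Or.inr ⟨h1.symm, h2.symm, fun h => h3 h.symm⟩)⟩
  loopless := ⟨by
    rintro v (⟨_, h2, _⟩ | ⟨h1, _, _⟩ | ⟨_, _, h3⟩)
    · exact v.isTriangle.2.2.ne h2
    · exact v.isTriangle.1.ne h1
    · exact h3 rfl⟩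

/-! The Grassmann algebra `ExteriorAlgebra K V` over an ordered field `K`. -/

section Grassmann

variable {K : Type*} [Field K] {V : Type*} [AddCommGroup V] [Module K V]

/-- Even elements of the Grassmann algebra. -/
def IsEven (x : ExteriorAlgebra K V) : Prop :=
  x ∈ CliffordAlgebra.evenOdd (0 : QuadraticForm K V) 0

/-- Odd elements of the Grassmann algebra. -/
def IsOdd (x : ExteriorAlgebra K V) : Prop :=
  x ∈ CliffordAlgebra.evenOdd (0 : QuadraticForm K V) 1

/-- The body (degree-zero part) of an element of the Grassmann algebra. -/
noncomputable def body (x : ExteriorAlgebra K V) : K :=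
  ExteriorAlgebra.algebraMapInv x

/-- Positive elements: even, with positive body. -/
def IsPos [LinearOrder K] (x : ExteriorAlgebra K V) : Prop :=
  IsEven x ∧ 0 < body x

open Classical in
/-- The positive square root of a positive element (zero if there is none). -/
noncomputable def superSqrt [LinearOrder K] (x : ExteriorAlgebra K V) : ExteriorAlgebra K V :=
  if h : ∃ y : ExteriorAlgebra K V, IsPos y ∧ y * y = x then h.choose else 0

/-- The matrix `E(x)`; its inverse is `E(-x)`. -/
noncomputable def matE (x : ExteriorAlgebra K V) : Matrix (Fin 3) (Fin 3) (ExteriorAlgebra K V) :=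
  !![0, -x, 0;
     Ring.inverse x, 0, 0;
     0, 0, 1]

/-- The matrix `A(h|θ)`. -/
noncomputable def matA [LinearOrder K] (h θ : ExteriorAlgebra K V) :
    Matrix (Fin 3) (Fin 3) (ExteriorAlgebra K V) :=
  !![1, 0, 0;
     h, 1, -(superSqrt h * θ);
     superSqrt h * θ, 0, 1]

/-- The inverse of the matrix `A(h|θ)`. -/
noncomputable def matAInv [LinearOrder K] (h θ : ExteriorAlgebra K V) :
    Matrix (Fin 3) (Fin 3) (ExteriorAlgebra K V) :=
  !![1, 0, 0;
     -h, 1, superSqrt h * θ;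
     -(superSqrt h * θ), 0, 1]

/-- The fermionic reflection `ρ`. -/
def matRho : Matrix (Fin 3) (Fin 3) (ExteriorAlgebra K V) :=
  !![-1, 0, 0;
     0, -1, 0;
     0, 0, 1]

end Grassmann

/-- A triangulation of the `n`-gon with an orientation of its arcs (`orient a b`: the arc `ab` is
directed from `a` to `b`), and a point of the decorated super Teichmüller space in the
corresponding coordinates: an even `λ`-length with positive body for each arc, an odd `μ`-invariant
for each triangle. Only the values on arcs and triangles of the triangulation matter. -/
structure SuperDecoration (K : Type*) [Field K] [LinearOrder K] (V : Type*) [AddCommGroup V]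
    [Module K V] (n : ℕ) extends PolygonTriangulation n where
  orient : Fin n → Fin n → Prop
  orient_xor : ∀ a b, graph.Adj a b → Xor (orient a b) (orient b a)
  lam : Fin n → Fin n → ExteriorAlgebra K V
  lam_symm : ∀ a b, graph.Adj a b → lam a b = lam b a
  lam_pos : ∀ a b, graph.Adj a b → IsPos (lam a b)
  mu : Fin n → Fin n → Fin n → ExteriorAlgebra K V
  mu_swap : ∀ a b c, toPolygonTriangulation.IsTriangle a b c → mu a b c = mu b a c
  mu_rotate : ∀ a b c, toPolygonTriangulation.IsTriangle a b c → mu a b c = mu b c a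
  mu_odd : ∀ a b c, toPolygonTriangulation.IsTriangle a b c → IsOdd (mu a b c)

namespace SuperDecoration

variable {K : Type*} [Field K] [LinearOrder K] {V : Type*} [AddCommGroup V] [Module K V] {n : ℕ}

/-- The `h`-length `λ_{jk} / (λ_{ij} λ_{ik})` at the vertex `i` of the triangle `ijk`. -/
noncomputable def hLength (D : SuperDecoration K V n) (i j k : Fin n) : ExteriorAlgebra K V :=
  D.lam j k * Ring.inverse (D.lam i j * D.lam i k)

open Classical in
/-- The matrix that the connection assigns to the edge of `Γ_T` directed from `v` to `w`. Angle
edges carry `A` or its inverse, parallel edges carry `E` or its inverse, according as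
they run clockwise or counterclockwise around their hexagon; an edge crossing a diagonal carries the
identity if it is near the source of the diagonal, and `ρ` if it is near its target. -/
noncomputable def edgeMatrix (D : SuperDecoration K V n)
    (v w : GammaVertex D.toPolygonTriangulation) :
    Matrix (Fin 3) (Fin 3) (ExteriorAlgebra K V) :=
  if v.AngleEdge w then
    if Ccw v.near v.side v.opp then
      matA (D.hLength v.near v.side v.opp) (D.mu v.near v.side v.opp)
    else
      matAInv (D.hLength v.near v.side v.opp) (D.mu v.near v.side v.opp)
  else if v.ParallelEdge w then
    if Ccw v.near v.opp v.side then
      matE (D.lam v.near v.side)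
    else
      matE (-D.lam v.near v.side)
  else
    if D.orient v.near v.side then 1 else matRho

/-- The holonomy along a path in `Γ_T`: the product of the matrices of its edges, the
first edge being the rightmost factor. -/
noncomputable def holonomy (D : SuperDecoration K V n) :
    {v w : GammaVertex D.toPolygonTriangulation} →
      (gammaGraph D.toPolygonTriangulation).Walk v w →
      Matrix (Fin 3) (Fin 3) (ExteriorAlgebra K V)
  | _, _, .nil => 1
  | v, _, .cons (v := u) _ p => holonomy D p * D.edgeMatrix v u

/-- The super Ptolemy transformation: `D'` arises from `D` by flipping the diagonal `ik`, directed
from `i` to `k`, of the quadrilateral with vertices `i, j, k, l` in counterclockwise order. The new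
diagonal is directed from `j` to `l`, and the side `kl` changes its direction. -/
structure IsFlip (D D' : SuperDecoration K V n) (i j k l : Fin n) : Prop where
  ccw_left : Ccw i j k
  ccw_right : Ccw i k l
  triangle_left : D.IsTriangle i j k
  triangle_right : D.IsTriangle i k l
  orient_old : D.orient i k
  adj_iff : ∀ a b, D'.graph.Adj a b ↔
    (D.graph.Adj a b ∧ s(a, b) ≠ s(i, k)) ∨ s(a, b) = s(j, l)
  orient_new : D'.orient j l
  orient_rev : D'.orient k l ↔ D.orient l k
  orient_other : ∀ a b, D'.graph.Adj a b → s(a, b) ≠ s(j, l) → s(a, b) ≠ s(k, l) →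
    (D'.orient a b ↔ D.orient a b)
  lam_other : ∀ a b, D'.graph.Adj a b → s(a, b) ≠ s(j, l) → D'.lam a b = D.lam a b
  lam_new : D.lam i k * D'.lam j l =
    D.lam i l * D.lam j k + D.lam k l * D.lam i j +
      superSqrt (D.lam i l * D.lam k l * D.lam j k * D.lam i j) * D.mu i j k * D.mu i k l
  mu_other : ∀ a b c, D'.IsTriangle a b c →
    s(a, b) ≠ s(j, l) → s(a, c) ≠ s(j, l) → s(b, c) ≠ s(j, l) → D'.mu a b c = D.mu a b c
  mu_right : D'.mu j k l =
    (D.mu i j k * superSqrt (D.lam k l * D.lam i j) -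
      D.mu i k l * superSqrt (D.lam i l * D.lam j k)) *
      Ring.inverse (superSqrt (D.lam i l * D.lam j k + D.lam k l * D.lam i j))
  mu_left : D'.mu i j l =
    (D.mu i k l * superSqrt (D.lam k l * D.lam i j) +
      D.mu i j k * superSqrt (D.lam i l * D.lam j k)) *
      Ring.inverse (superSqrt (D.lam i l * D.lam j k + D.lam k l * D.lam i j))

/-- `x` is the super `λ`-length `λ_{ij}`: the `λ`-length of the arc `ij` in some triangulation
that contains this arc and is reached from `D` by a sequence of super Ptolemy transformations.
By convention `λ_{ii} = 0`. -/
def IsLambdaLength (D : SuperDecoration K V n) (i j : Fin n) (x : ExteriorAlgebra K V) : Prop :=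
  (i = j ∧ x = 0) ∨
    ∃ D' : SuperDecoration K V n,
      Relation.ReflTransGen (fun D₁ D₂ => ∃ a b c d, IsFlip D₁ D₂ a b c d) D D' ∧
        D'.graph.Adj i j ∧ x = D'.lam i j

end SuperDecoration

/-! ### Parity, body and nilpotents in the Grassmann algebra. -/

section GrassmannParity

variable {K : Type*} [Field K] {V : Type*} [AddCommGroup V] [Module K V]

/-! The connection on $\Gamma_T$ is flat, and flatness is used in integrated form: a potential
assigns an invertible matrix to every vertex of $\Gamma_T$ so that each edge matrix carries the
value at its source to the value at its target. Holonomies then telescope (`holonomy_eq`), which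
gives path independence. A potential exists because the monodromy is trivial around hexagons
(`hexagon_monodromy`) and around the squares across diagonals (`side_symm`), and because the
triangles of a polygon are glued in a tree, so that values can be built triangle by triangle
(`exists_potentialOn_Icc`).

Near a polygon vertex $a$ the edges carry $A^{\pm1}$, $1$ or $\rho$. These lie in the group
`stabilizing` of matrices whose first row is $\pm(1,0,0)$ and whose second column is $\pm(0,1,0)^T$;
multiplication by them on either side changes a (1,2)-entry at most by a sign. So all values near
$a$ lie in one coset, represented by `R a`, and every holonomy from $i$ to $j$ has, up to sign, the
(1,2)-entry of `R j * (R i)⁻¹`. For an arc of the triangulation, the edge parallel to it shows that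
this entry is $\pm\lambda_{ij}$ (`lam_eq`).

The super Ptolemy relations say that the angle matrices on the two sides of a diagonal multiply to
that of the merged angle (`angleMat_relations`). Hence a flip turns a potential into one with the
same `R` (`IsFlip.exists_potential`). The $\lambda$-length of $ij$ after any flips is thus one fixed
entry up to sign, and the positive body decides the sign. Every arc is reached, since some flip
lowers the number of arcs crossing it (`exists_flip_card_lt`). -/

theorem IsEven.commute_ι {x : ExteriorAlgebra K V} (hx : IsEven x) (v : V) :
    Commute x (ExteriorAlgebra.ι K v) := by
  induction x, hx using CliffordAlgebra.even_induction with
  | algebraMap r => exact Algebra.commutes r _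
  | add x y _ _ hx hy => exact hx.add_left hy
  | ι_mul_ι_mul m₁ m₂ x _ hx =>
    refine Commute.mul_left ?_ hx
    have h₁ := eq_neg_of_add_eq_zero_left (ExteriorAlgebra.ι_add_mul_swap (R := K) m₁ v)
    have h₂ := eq_neg_of_add_eq_zero_left (ExteriorAlgebra.ι_add_mul_swap (R := K) m₂ v)
    change ExteriorAlgebra.ι K m₁ * ExteriorAlgebra.ι K m₂ * ExteriorAlgebra.ι K v =
      ExteriorAlgebra.ι K v * (ExteriorAlgebra.ι K m₁ * ExteriorAlgebra.ι K m₂)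
    rw [mul_assoc, h₂, mul_neg, ← mul_assoc, h₁, neg_mul, neg_neg, mul_assoc]

theorem IsEven.commute {x : ExteriorAlgebra K V} (hx : IsEven x) (y : ExteriorAlgebra K V) :
    Commute x y := by
  induction y using ExteriorAlgebra.induction with
  | algebraMap r => exact (Algebra.commutes r x).symm
  | ι v => exact hx.commute_ι v
  | mul a b ha hb => exact ha.mul_right hb
  | add a b ha hb => exact ha.add_right hb

theorem IsOdd.ι_mul {y : ExteriorAlgebra K V} (hy : IsOdd y) (v : V) :
    ExteriorAlgebra.ι K v * y = -(y * ExteriorAlgebra.ι K v) := by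
  induction y, hy using CliffordAlgebra.odd_induction with
  | ι w => exact eq_neg_of_add_eq_zero_left (ExteriorAlgebra.ι_add_mul_swap v w)
  | add x y _ _ hx hy => rw [mul_add, hx, hy, add_mul, neg_add]
  | ι_mul_ι_mul m₁ m₂ x _ hx =>
    have hc := (IsEven.commute (K := K)
      (CliffordAlgebra.ι_mul_ι_mem_evenOdd_zero 0 m₁ m₂) (ExteriorAlgebra.ι K v)).eq
    rw [← mul_assoc, ← hc, mul_assoc, hx, mul_neg, mul_assoc _ x]

theorem IsOdd.mul_eq_neg {x y : ExteriorAlgebra K V} (hx : IsOdd x) (hy : IsOdd y) :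
    x * y = -(y * x) := by
  induction x, hx using CliffordAlgebra.odd_induction with
  | ι w => exact hy.ι_mul w
  | add a b _ _ ha hb => rw [add_mul, ha, hb, mul_add, neg_add]
  | ι_mul_ι_mul m₁ m₂ x _ hx =>
    have hc := (IsEven.commute (K := K)
      (CliffordAlgebra.ι_mul_ι_mem_evenOdd_zero 0 m₁ m₂) y).eq
    rw [mul_assoc, hx, mul_neg, ← mul_assoc, hc, mul_assoc]

theorem IsOdd.mul_self [CharZero K] {x : ExteriorAlgebra K V} (hx : IsOdd x) : x * x = 0 := by
  have h := hx.mul_eq_neg hx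
  have h2 : (2 : K) • (x * x) = 0 := by rw [two_smul]; exact eq_neg_iff_add_eq_zero.mp h
  exact (smul_eq_zero.mp h2).resolve_left two_ne_zero

theorem IsEven.add {x y : ExteriorAlgebra K V} (hx : IsEven x) (hy : IsEven y) : IsEven (x + y) :=
  Submodule.add_mem _ hx hy

theorem IsEven.mul {x y : ExteriorAlgebra K V} (hx : IsEven x) (hy : IsEven y) : IsEven (x * y) :=
  (CliffordAlgebra.even (0 : QuadraticForm K V)).mul_mem hx hy

theorem isEven_algebraMap (r : K) : IsEven (algebraMap K (ExteriorAlgebra K V) r) :=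
  (CliffordAlgebra.even (0 : QuadraticForm K V)).algebraMap_mem r

theorem IsOdd.mul {x y : ExteriorAlgebra K V} (hx : IsOdd x) (hy : IsOdd y) : IsEven (x * y) := by
  have := SetLike.mul_mem_graded (A := CliffordAlgebra.evenOdd (0 : QuadraticForm K V)) hx hy
  exact this

theorem IsEven.mul_odd {x y : ExteriorAlgebra K V} (hx : IsEven x) (hy : IsOdd y) :
    IsOdd (x * y) := by
  have := SetLike.mul_mem_graded (A := CliffordAlgebra.evenOdd (0 : QuadraticForm K V)) hx hy
  exact this

theorem IsOdd.add {x y : ExteriorAlgebra K V} (hx : IsOdd x) (hy : IsOdd y) : IsOdd (x + y) :=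
  Submodule.add_mem _ hx hy

theorem IsOdd.neg {x : ExteriorAlgebra K V} (hx : IsOdd x) : IsOdd (-x) :=
  Submodule.neg_mem _ hx

theorem body_add (x y : ExteriorAlgebra K V) : body (x + y) = body x + body y := map_add _ x y

theorem body_mul (x y : ExteriorAlgebra K V) : body (x * y) = body x * body y := map_mul _ x y

theorem body_neg (x : ExteriorAlgebra K V) : body (-x) = -body x := map_neg _ x

theorem body_algebraMap (r : K) : body (algebraMap K (ExteriorAlgebra K V) r) = r :=
  AlgHom.commutes _ r

theorem body_ι (v : V) : body (ExteriorAlgebra.ι K v) = 0 := by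
  simp [body, ExteriorAlgebra.algebraMapInv]

theorem IsOdd.body_eq_zero [CharZero K] {x : ExteriorAlgebra K V} (hx : IsOdd x) : body x = 0 := by
  have h : body x * body x = 0 := by
    rw [← body_mul, hx.mul_self]; exact map_zero (ExteriorAlgebra.algebraMapInv (R := K) (M := V))
  exact mul_self_eq_zero.mp h

/-- The even part of the Grassmann algebra. -/
abbrev EvenPart (K : Type*) [Field K] (V : Type*) [AddCommGroup V] [Module K V] : Type _ :=
  CliffordAlgebra.even (0 : QuadraticForm K V)

/-- With a commutative even part, even elements serve as scalars on $\Lambda$ for `ring`, `module`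
and `match_scalars`; the identities of hexagons and flips are checked in this form. -/
noncomputable instance : CommRing (EvenPart K V) :=
  { (inferInstance : Ring (EvenPart K V)) with
    mul_comm := fun x y => Subtype.ext (IsEven.commute x.2 y.1) }

noncomputable instance : Algebra (EvenPart K V) (ExteriorAlgebra K V) where
  smul x y := x.1 * y
  algebraMap := (CliffordAlgebra.even (0 : QuadraticForm K V)).subtype
  commutes' x y := IsEven.commute x.2 y
  smul_def' _ _ := rfl

/-- A product of two vectors is even with square zero, and commuting nilpotents have nilpotent sums;
the dimension of $V$ plays no role. -/
theorem isNilpotent_of_body_eq_zero {x : ExteriorAlgebra K V} (hx : IsEven x) (h : body x = 0) :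
    IsNilpotent x := by
  -- Subtracting the body makes the claim meaningful for all even elements, as the induction
  -- requires.
  suffices H : IsNilpotent (x - algebraMap K _ (body x)) by simpa [h] using H
  clear h
  induction x, hx using CliffordAlgebra.even_induction with
  | algebraMap r =>
    have : body (algebraMap K (ExteriorAlgebra K V) r) = r := body_algebraMap r
    change IsNilpotent (algebraMap K (ExteriorAlgebra K V) r - algebraMap K _ (body
      (algebraMap K (ExteriorAlgebra K V) r)))
    rw [this, sub_self]; exact IsNilpotent.zero
  | add x y hx hy hx' hy' =>
    have hc : Commute (x - algebraMap K _ (body x)) (y - algebraMap K _ (body y)) :=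
      IsEven.commute (Submodule.sub_mem _ hx (isEven_algebraMap _)) _
    have := hc.isNilpotent_add hx' hy'
    convert this using 1
    erw [body_add]; rw [map_add]; abel
  | ι_mul_ι_mul m₁ m₂ x hx _ =>
    have he : IsEven (ExteriorAlgebra.ι K m₁ * ExteriorAlgebra.ι K m₂) :=
      CliffordAlgebra.ι_mul_ι_mem_evenOdd_zero 0 m₁ m₂
    have hb : body (ExteriorAlgebra.ι K m₁ * ExteriorAlgebra.ι K m₂ * x) = 0 := by
      rw [body_mul, body_mul, body_ι]; ring
    change IsNilpotent (ExteriorAlgebra.ι K m₁ * ExteriorAlgebra.ι K m₂ * x - algebraMap K _ (body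
      (ExteriorAlgebra.ι K m₁ * ExteriorAlgebra.ι K m₂ * x)))
    rw [hb, map_zero, sub_zero]
    refine Commute.isNilpotent_mul_right (he.commute x) ⟨2, ?_⟩
    rw [sq, mul_assoc, ← mul_assoc _ _ (ExteriorAlgebra.ι K m₂), (IsOdd.ι_mul (K := K)
      (CliffordAlgebra.ι_mem_evenOdd_one 0 m₁) m₂ : ExteriorAlgebra.ι K m₂ *
        ExteriorAlgebra.ι K m₁ = _)]
    rw [neg_mul, mul_neg, ← mul_assoc, ← mul_assoc, ExteriorAlgebra.ι_sq_zero]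
    simp

theorem EvenPart.isNilpotent {x : EvenPart K V} (h : body x.1 = 0) : IsNilpotent x := by
  obtain ⟨n, hn⟩ := isNilpotent_of_body_eq_zero x.2 h
  exact ⟨n, Subtype.ext hn⟩

theorem EvenPart.isUnit {x : EvenPart K V} (h : body x.1 ≠ 0) : IsUnit x := by
  have h1 : IsUnit (algebraMap K (EvenPart K V) (body x.1)) := (IsUnit.mk0 _ h).map _
  have h2 : IsNilpotent (x - algebraMap K (EvenPart K V) (body x.1)) := by
    apply EvenPart.isNilpotent
    change body (x.1 - algebraMap K _ (body x.1)) = 0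
    rw [sub_eq_add_neg, body_add, body_neg, body_algebraMap, add_neg_cancel]
  simpa using h2.isUnit_add_left_of_commute h1 (Commute.all _ _)

theorem IsPos.isUnit_even [LinearOrder K] {x : ExteriorAlgebra K V} (hx : IsPos x) :
    IsUnit (⟨x, hx.1⟩ : EvenPart K V) :=
  EvenPart.isUnit hx.2.ne'

theorem IsPos.isUnit [LinearOrder K] {x : ExteriorAlgebra K V} (hx : IsPos x) : IsUnit x :=
  hx.isUnit_even.map (algebraMap (EvenPart K V) (ExteriorAlgebra K V))

end GrassmannParity

/-! ### Positive elements and their square roots. -/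

section GrassmannSqrt

variable {K : Type*} [Field K] [LinearOrder K] [IsStrictOrderedRing K]
  {V : Type*} [AddCommGroup V] [Module K V]

/-- Square roots of positive elements, as positive elements of the even part. -/
theorem IsPos.exists_sqrt (hK : ∀ x : K, 0 ≤ x → IsSquare x) {x : ExteriorAlgebra K V}
    (hx : IsPos x) : ∃ y : ExteriorAlgebra K V, IsPos y ∧ y * y = x := by
  obtain ⟨s, hs⟩ := hK _ hx.2.le
  have hs0 : s ≠ 0 := by rintro rfl; exact hx.2.ne' (by simpa using hs)
  obtain ⟨c, hc0, hc⟩ : ∃ c : K, 0 < c ∧ c * c = body x :=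
    ⟨|s|, abs_pos.mpr hs0, by rw [abs_mul_abs_self, hs]⟩
  let z : EvenPart K V := ⟨x, hx.1⟩
  let w : EvenPart K V := algebraMap K _ c
  -- Newton iteration: modulo nilpotents `w` is a root of $X^2-z$, and the derivative $2w$ is a
  -- unit, so an exact root exists that differs from `w` by a nilpotent.
  let P : Polynomial (EvenPart K V) := Polynomial.X ^ 2 - Polynomial.C z
  have h1 : IsNilpotent (Polynomial.aeval w P) := by
    have : Polynomial.aeval w P = w * w - z := by simp [P, sq]
    rw [this]
    apply EvenPart.isNilpotent
    change body (algebraMap K _ c * algebraMap K _ c - x) = 0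
    rw [sub_eq_add_neg, body_add, body_neg, body_mul, body_algebraMap, hc, add_neg_cancel]
  have h2 : IsUnit (Polynomial.aeval w (Polynomial.derivative P)) := by
    have : Polynomial.aeval w (Polynomial.derivative P) = w + w := by
      simp only [P, Polynomial.derivative_sub, Polynomial.derivative_X_pow, Polynomial.derivative_C]
      simp
      ring
    rw [this]
    apply EvenPart.isUnit
    change body (algebraMap K _ c + algebraMap K _ c) ≠ 0
    rw [body_add, body_algebraMap]
    positivity
  obtain ⟨y, ⟨hy1, hy2⟩, -⟩ := Polynomial.existsUnique_nilpotent_sub_and_aeval_eq_zero h1 h2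
  have hy3 : y * y = z := by
    have : Polynomial.aeval y P = y * y - z := by simp [P, sq]
    rw [this] at hy2; exact sub_eq_zero.mp hy2
  refine ⟨y.1, ⟨y.2, ?_⟩, congrArg Subtype.val hy3⟩
  have hb : IsNilpotent (body (w - y).1) := by
    obtain ⟨n, hn⟩ := hy1
    refine ⟨n, ?_⟩
    have := congrArg (fun u : EvenPart K V => body u.1) hn
    change body ((w - y).1 ^ n) = body 0 at this
    rw [body, map_pow] at this
    rw [body, this]; exact map_zero (ExteriorAlgebra.algebraMapInv (R := K) (M := V))
  have hb' : body (algebraMap K (ExteriorAlgebra K V) c - y.1) = 0 := hb.eq_zero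
  rw [sub_eq_add_neg, body_add, body_neg, body_algebraMap, add_neg_eq_zero] at hb'
  exact hb' ▸ hc0

theorem superSqrt_spec (hK : ∀ x : K, 0 ≤ x → IsSquare x) {x : ExteriorAlgebra K V}
    (hx : IsPos x) : IsPos (superSqrt x) ∧ superSqrt x * superSqrt x = x := by
  have h := hx.exists_sqrt hK
  rw [superSqrt, dif_pos h]
  exact h.choose_spec

theorem IsPos.add {x y : ExteriorAlgebra K V} (hx : IsPos x) (hy : IsPos y) : IsPos (x + y) :=
  ⟨hx.1.add hy.1, by rw [body_add]; exact add_pos hx.2 hy.2⟩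

theorem IsPos.mul {x y : ExteriorAlgebra K V} (hx : IsPos x) (hy : IsPos y) : IsPos (x * y) :=
  ⟨hx.1.mul hy.1, by rw [body_mul]; exact mul_pos hx.2 hy.2⟩

/-- $(x-y)(x+y)=0$, and $x+y$ is positive, hence a unit. -/
theorem IsPos.mul_self_injective {x y : ExteriorAlgebra K V} (hx : IsPos x) (hy : IsPos y)
    (h : x * x = y * y) : x = y := by
  have h1 : (x - y) * (x + y) = 0 := by
    rw [sub_mul, mul_add, mul_add, h, (hx.1.commute y).eq]; abel
  exact sub_eq_zero.mp (((hx.add hy).isUnit.mul_left_eq_zero).mp h1)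

/-- Removes the sign ambiguity of matrix entries when $\lambda$-lengths are compared. -/
theorem IsPos.eq_of_eq_or_eq_neg {x y : ExteriorAlgebra K V} (hx : IsPos x) (hy : IsPos y)
    (h : x = y ∨ x = -y) : x = y := by
  refine h.resolve_right fun h => ?_
  have h1 := hx.2
  rw [h, body_neg] at h1
  linarith [hy.2]

theorem superSqrt_eq {x y : ExteriorAlgebra K V} (hy : IsPos y) (h : y * y = x) :
    superSqrt x = y := by
  have hx : ∃ y : ExteriorAlgebra K V, IsPos y ∧ y * y = x := ⟨y, hy, h⟩
  rw [superSqrt, dif_pos hx]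
  exact hx.choose_spec.1.mul_self_injective hy (hx.choose_spec.2.trans h.symm)

theorem IsPos.inverse {x : ExteriorAlgebra K V} (hx : IsPos x) : IsPos (Ring.inverse x) := by
  obtain ⟨y, hy⟩ := hx.isUnit_even.exists_right_inv
  have hy' : x * y.1 = 1 := congrArg Subtype.val hy
  have h : Ring.inverse x = y.1 := by
    rw [← mul_one (Ring.inverse x), ← hy', ← mul_assoc, Ring.inverse_mul_cancel _ hx.isUnit,
      one_mul]
  have hb : body x * body (Ring.inverse x) = 1 := by
    rw [h, ← body_mul, hy']; exact map_one (ExteriorAlgebra.algebraMapInv (R := K) (M := V))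
  exact ⟨h ▸ y.2, pos_of_mul_pos_right (by rw [hb]; exact one_pos) hx.2.le⟩

end GrassmannSqrt

/-! ### Matrix identities around a hexagon. -/

section MatrixAlgebra

/-- The common shape of the matrices `A(h|θ)` and their inverses. -/
def shearMat {Λ : Type*} [Ring Λ] (h m : Λ) : Matrix (Fin 3) (Fin 3) Λ :=
  !![1, 0, 0;
     h, 1, -m;
     m, 0, 1]

/-- The correction $m_1m_2$ is what becomes the $\sigma\theta$ term of the Ptolemy relation when two
angles at a vertex merge. -/
theorem shearMat_mul {Λ : Type*} [Ring Λ] (h₁ m₁ h₂ m₂ : Λ) :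
    shearMat h₁ m₁ * shearMat h₂ m₂ = shearMat (h₁ + h₂ - m₁ * m₂) (m₁ + m₂) := by
  ext a b
  fin_cases a <;> fin_cases b <;>
    simp [shearMat, Matrix.mul_apply, Fin.sum_univ_three, sub_eq_add_neg, add_comm]

theorem shearMat_zero {Λ : Type*} [Ring Λ] : shearMat (0 : Λ) 0 = 1 := by
  ext a b
  fin_cases a <;> fin_cases b <;> simp [shearMat]

/-- `E(x)` with an explicit inverse `y` of `x`. -/
def rotMat {Λ : Type*} [Ring Λ] (x y : Λ) : Matrix (Fin 3) (Fin 3) Λ :=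
  !![0, -x, 0;
     y, 0, 0;
     0, 0, 1]

variable {R : Type*} [CommRing R] {Λ : Type*} [Ring Λ] [Algebra R Λ]

/-- `h` and `m` are the `h`-length and the odd entry `√h μ` at a corner of a triangle, where `z` is
the square root of the opposite side and `x`, `y` are those of the adjacent ones. -/
structure IsTriangleCorner (x y z : R) (μ h m : Λ) : Prop where
  even : (x * x * (y * y)) • h = (z * z) • (1 : Λ)
  odd : (x * y) • m = z • μ

/-- The monodromy around a hexagon is trivial. -/
theorem hexagon_monodromy {x y z : R} (hx : IsUnit x) (hy : IsUnit y) (hz : IsUnit z)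
    {μ h₁ m₁ h₂ m₂ h₃ m₃ : Λ} (hμ : μ * μ = 0)
    (c₁ : IsTriangleCorner y z x μ h₁ m₁) (c₂ : IsTriangleCorner z x y μ h₂ m₂) (c₃ : IsTriangleCorner x y z μ h₃ m₃)
    {x' y' z' : Λ} (hx' : (x * x) • x' = 1) (hy' : (y * y) • y' = 1) (hz' : (z * z) • z' = 1) :
    rotMat ((x * x) • 1) x' * shearMat h₃ m₃ * rotMat ((y * y) • 1) y' * shearMat h₁ m₁ *
      rotMat ((z * z) • 1) z' * shearMat h₂ m₂ = 1 := by
  obtain ⟨x, rfl⟩ := hx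
  obtain ⟨y, rfl⟩ := hy
  obtain ⟨z, rfl⟩ := hz
  -- With names for the inverses, each `h` and `m` is solved for, and all entries become polynomial
  -- in the six scalars and $\mu$.
  obtain ⟨a, ha⟩ : ∃ a : R, a = ((x⁻¹ : Rˣ) : R) := ⟨_, rfl⟩
  obtain ⟨b, hb⟩ : ∃ b : R, b = ((y⁻¹ : Rˣ) : R) := ⟨_, rfl⟩
  obtain ⟨c, hc⟩ : ∃ c : R, c = ((z⁻¹ : Rˣ) : R) := ⟨_, rfl⟩
  have hxa : (x : R) * a = 1 := by simp [ha]
  have hyb : (y : R) * b = 1 := by simp [hb]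
  have hzc : (z : R) * c = 1 := by simp [hc]
  have inv : ∀ {u v : R} {w w' : Λ}, u * v = 1 → u • w = w' → w = v • w' := by
    intro u v w w' h1 h2
    rw [← h2, smul_smul, mul_comm, h1, one_smul]
  obtain rfl := inv (v := a * a) (by linear_combination ((x : R) * a + 1) * hxa) hx'
  obtain rfl := inv (v := b * b) (by linear_combination ((y : R) * b + 1) * hyb) hy'
  obtain rfl := inv (v := c * c) (by linear_combination ((z : R) * c + 1) * hzc) hz'
  have sq : ∀ {u v u' v' : R}, u * u' = 1 → v * v' = 1 → (u * v) * (u' * v') = 1 := by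
    intro u v u' v' h1 h2
    linear_combination (v * v') * h1 + h2
  obtain rfl := inv (sq (sq hyb hyb) (sq hzc hzc)) c₁.even
  obtain rfl := inv (sq (sq hzc hzc) (sq hxa hxa)) c₂.even
  obtain rfl := inv (sq (sq hxa hxa) (sq hyb hyb)) c₃.even
  obtain rfl := inv (sq hyb hzc) c₁.odd
  obtain rfl := inv (sq hzc hxa) c₂.odd
  obtain rfl := inv (sq hxa hyb) c₃.odd
  generalize (x : R) = x at *
  generalize (y : R) = y at *
  generalize (z : R) = z at *
  ext i j
  fin_cases i <;> fin_cases j <;>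
    simp [rotMat, shearMat, Matrix.mul_apply, Fin.sum_univ_three, hμ, smul_smul,
      add_mul]
  -- As $\mu^2=0$, each entry is linear in $1$ and $\mu$; coefficients are compared using
  -- $xa=yb=zc=1$.
  all_goals
    clear hx' hy' hz' ha hb hc
    match_scalars
    all_goals grind

end MatrixAlgebra

/-! ### The super Ptolemy relations at the corners of a quadrilateral. -/

section FlipAlgebra

variable {R : Type*} [CommRing R] {Λ : Type*} [Ring Λ] [Algebra R Λ]

/-- The square roots of the `λ`-lengths of the sides `il`, `kl`, `jk`, `ij` and of the diagonals
`ik`, `jl` of a quadrilateral, and the `μ`-invariants before and after a flip. -/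
structure SuperPtolemy (p q r s u v t : R) (σ θ μL μR : Λ) : Prop where
  hp : IsUnit p
  hq : IsUnit q
  hr : IsUnit r
  hs : IsUnit s
  hu : IsUnit u
  hv : IsUnit v
  ht : IsUnit t
  huvt : IsUnit (u * v + t)
  t_sq : t * t = p * p * (r * r) + q * q * (s * s)
  σσ : σ * σ = 0
  θθ : θ * θ = 0
  θσ : θ * σ = -(σ * θ)
  uv_sq : (u * u * (v * v)) • (1 : Λ) = (t * t) • (1 : Λ) + (p * q * r * s) • (σ * θ)
  left : t • μL = (q * s) • θ + (p * r) • σ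
  right : t • μR = (q * s) • σ - (p * r) • θ

namespace SuperPtolemy

variable {p q r s u v t : R} {σ θ μL μR : Λ}

/-- $(uv)^2-t^2$ is a multiple of $\sigma\theta$, which $\sigma$ kills; the unit $uv+t$ cancels. -/
theorem uv_σ (P : SuperPtolemy p q r s u v t σ θ μL μR) : (u * v) • σ = t • σ := by
  rw [← P.huvt.smul_left_cancel]
  have h := congrArg (σ * ·) P.uv_sq
  simp only [mul_add, mul_smul_comm, mul_one, ← mul_assoc, P.σσ, zero_mul, smul_zero] at h
  linear_combination (norm := module) h

theorem uv_θ (P : SuperPtolemy p q r s u v t σ θ μL μR) : (u * v) • θ = t • θ := by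
  rw [← P.huvt.smul_left_cancel]
  have h := congrArg (· * θ) P.uv_sq
  simp only [add_mul, smul_mul_assoc, one_mul, mul_assoc, P.θθ, mul_zero, smul_zero] at h
  linear_combination (norm := module) h

/-- The passage from $(\sigma,\theta)$ to $(\mu_L,\mu_R)$ has determinant $-((pr)^2+(qs)^2)/t^2=-1$.
-/
theorem left_mul_right (P : SuperPtolemy p q r s u v t σ θ μL μR) : μL * μR = -(σ * θ) := by
  rw [← (P.ht.mul P.ht).smul_left_cancel, ← smul_mul_smul_comm, P.left, P.right, P.t_sq]
  simp only [add_mul, mul_sub, smul_mul_smul_comm, P.σσ, P.θθ, P.θσ]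
  module

/-- At the source of the old diagonal the crossing edge carries the identity, so the two angle
matrices just multiply. -/
theorem corner_i (P : SuperPtolemy p q r s u v t σ θ μL μR) {h h₁ h₂ m m₁ m₂ : Λ}
    (c : IsTriangleCorner s p v μL h m) (c₁ : IsTriangleCorner u p q θ h₁ m₁) (c₂ : IsTriangleCorner s u r σ h₂ m₂) :
    shearMat h m = shearMat h₁ m₁ * shearMat h₂ m₂ := by
  have hm : (u * p * (s * u)) • (m₁ * m₂) = -((q * r) • (σ * θ)) := by
    rw [← smul_mul_smul_comm, c₁.odd, c₂.odd, smul_mul_smul_comm, P.θσ, smul_neg]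
  rw [shearMat_mul]
  congr 1
  · rw [← ((P.hu.mul P.hu).mul ((P.hs.mul P.hs).mul (P.hp.mul P.hp))).smul_left_cancel]
    have := P.uv_sq
    rw [P.t_sq] at this
    linear_combination (norm := module) (u * u) • c.even - (s * s) • c₁.even - (p * p) • c₂.even +
      (s * p) • hm + this
  · rw [← (P.ht.mul (P.hu.mul (P.hs.mul P.hp))).smul_left_cancel]
    linear_combination (norm := module) (t * u) • c.odd - (t * s) • c₁.odd - (t * p) • c₂.odd +
      (u * v) • P.left + (q * s) • P.uv_θ + (p * r) • P.uv_σ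

/-- At the target of the old diagonal one angle matrix has to be moved past $\rho$, which negates
its odd entry. -/
theorem corner_k (P : SuperPtolemy p q r s u v t σ θ μL μR) {h h₁ h₂ m m₁ m₂ : Λ}
    (c : IsTriangleCorner q r v μR h m) (c₁ : IsTriangleCorner u r s σ h₁ m₁) (c₂ : IsTriangleCorner q u p θ h₂ m₂) :
    shearMat h m = shearMat h₁ m₁ * shearMat h₂ (-m₂) := by
  have hm : (u * r * (q * u)) • (m₁ * m₂) = (s * p) • (σ * θ) := by
    rw [← smul_mul_smul_comm, c₁.odd, c₂.odd, smul_mul_smul_comm]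
  rw [shearMat_mul]
  congr 1
  · rw [← ((P.hu.mul P.hu).mul ((P.hq.mul P.hq).mul (P.hr.mul P.hr))).smul_left_cancel]
    have := P.uv_sq
    rw [P.t_sq] at this
    rw [mul_neg]
    linear_combination (norm := module) (u * u) • c.even - (q * q) • c₁.even - (r * r) • c₂.even -
      (q * r) • hm + this
  · rw [← (P.ht.mul (P.hu.mul (P.hq.mul P.hr))).smul_left_cancel]
    linear_combination (norm := module) (t * u) • c.odd - (t * q) • c₁.odd + (t * r) • c₂.odd +
      (u * v) • P.right + (q * s) • P.uv_σ - (p * r) • P.uv_θ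

/-- Here the new diagonal cuts the angle, so old and new exchange roles. The corner at $l$ needs no
identity, since it follows from the closing of hexagons. -/
theorem corner_j (P : SuperPtolemy p q r s u v t σ θ μL μR) {h h₁ h₂ m m₁ m₂ : Λ}
    (c : IsTriangleCorner r s u σ h m) (c₁ : IsTriangleCorner v s p μL h₁ m₁) (c₂ : IsTriangleCorner r v q μR h₂ m₂) :
    shearMat h m = shearMat h₁ m₁ * shearMat h₂ m₂ := by
  have hm : (v * s * (r * v)) • (m₁ * m₂) = -((p * q) • (σ * θ)) := by
    rw [← smul_mul_smul_comm, c₁.odd, c₂.odd, smul_mul_smul_comm, P.left_mul_right, smul_neg]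
  rw [shearMat_mul]
  congr 1
  · rw [← ((P.hv.mul P.hv).mul ((P.hr.mul P.hr).mul (P.hs.mul P.hs))).smul_left_cancel]
    have := P.uv_sq
    rw [P.t_sq] at this
    linear_combination (norm := module) (v * v) • c.even - (r * r) • c₁.even - (s * s) • c₂.even +
      (r * s) • hm + this
  · rw [← (P.ht.mul (P.hv.mul (P.hr.mul P.hs))).smul_left_cancel]
    have ht := congrArg (· • σ) P.t_sq
    beta_reduce at ht
    linear_combination (norm := module) (t * v) • c.odd - (t * r) • c₁.odd - (t * s) • c₂.odd -
      (p * r) • P.left - (q * s) • P.right + t • P.uv_σ + ht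

end SuperPtolemy

end FlipAlgebra

/-! ### Cyclic order of the polygon vertices. -/

section CyclicOrder

variable {n : ℕ} {a b c d x y : Fin n}

theorem Ccw.rotate (h : Ccw a b c) : Ccw b c a := by
  simp only [Ccw, Fin.lt_def] at *; omega

theorem Ccw.not_swap (h : Ccw a b c) : ¬ Ccw a c b := by
  simp only [Ccw, Fin.lt_def] at *; omega

theorem Ccw.ne₁₂ (h : Ccw a b c) : a ≠ b := by
  rintro rfl; simp only [Ccw, Fin.lt_def] at h; omega

theorem Ccw.ne₂₃ (h : Ccw a b c) : b ≠ c := h.rotate.ne₁₂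

theorem Ccw.ne₁₃ (h : Ccw a b c) : a ≠ c := h.rotate.ne₂₃.symm

theorem ccw_or_ccw (hab : a ≠ b) (hac : a ≠ c) (hbc : b ≠ c) : Ccw a b c ∨ Ccw a c b := by
  simp only [Ccw, Fin.lt_def, ne_eq, Fin.ext_iff] at *; omega

theorem Ccw.trans (h : Ccw a x y) (h' : Ccw a y b) : Ccw a x b := by
  simp only [Ccw, Fin.lt_def] at *; omega

theorem ccw_of_lt (h₁ : a < b) (h₂ : b < c) : Ccw a b c := Or.inl ⟨h₁, h₂⟩

theorem Crosses.symm (h : Crosses a b c d) : Crosses c d a b := by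
  simp only [Crosses, Ccw, Fin.lt_def] at *; omega

theorem Crosses.swap_left (h : Crosses a b c d) : Crosses b a c d := by
  simp only [Crosses, Ccw, Fin.lt_def] at *; omega

theorem Crosses.swap_right (h : Crosses a b c d) : Crosses a b d c := by
  simp only [Crosses, Ccw, Fin.lt_def] at *; omega

theorem crosses_of_ccw (h : Ccw a b c) (h' : Ccw a c d) : Crosses a c b d := by
  simp only [Crosses, Ccw, Fin.lt_def] at *; omega

theorem Crosses.ne (h : Crosses a b c d) : a ≠ c := by
  rintro rfl; simp only [Crosses, Ccw, Fin.lt_def] at h; omega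

theorem Ccw.trichotomy {j k l x : Fin n} (hx : Ccw j x l) (h : Ccw j k l) :
    x = k ∨ Ccw j x k ∨ Ccw k x l := by
  simp only [Ccw, Fin.lt_def, Fin.ext_iff] at *; omega

theorem Ccw.ccw_and {j k l y : Fin n} (hy : Ccw l y j) (h : Ccw j k l) :
    Ccw k y j ∧ Ccw l y k := by
  simp only [Ccw, Fin.lt_def] at *; omega

theorem Ccw.rotate_quad {i j k l : Fin n} (h₁ : Ccw i j k) (h₂ : Ccw i k l) :
    Ccw j k l ∧ Ccw l i j := by
  simp only [Ccw, Fin.lt_def] at *; omega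

end CyclicOrder

/-! ### Arcs and triangles of a triangulation. -/

namespace PolygonTriangulation

variable {n : ℕ} (T : PolygonTriangulation n) {a b c d x y : Fin n}

theorem IsTriangle.swap {T : PolygonTriangulation n} (h : T.IsTriangle a b c) :
    T.IsTriangle b a c :=
  ⟨h.1.symm, h.2.2, h.2.1⟩

theorem IsTriangle.rotate {T : PolygonTriangulation n} (h : T.IsTriangle a b c) :
    T.IsTriangle b c a :=
  ⟨h.2.2, h.1.symm, h.2.1.symm⟩

theorem IsTriangle.swap_right {T : PolygonTriangulation n} (h : T.IsTriangle a b c) :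
    T.IsTriangle a c b :=
  ⟨h.2.1, h.1, h.2.2.symm⟩

theorem IsTriangle.ccw_or {T : PolygonTriangulation n} (h : T.IsTriangle a b c) :
    Ccw a b c ∨ Ccw a c b :=
  ccw_or_ccw h.1.ne h.2.1.ne h.2.2.ne

/-- There is at most one triangle on each side of an arc. -/
theorem IsTriangle.unique {T : PolygonTriangulation n} (h : T.IsTriangle a b c)
    (h' : T.IsTriangle a b d) (hc : Ccw a b c) (hd : Ccw a b d) : c = d := by
  by_contra hne
  rcases ccw_or_ccw hc.ne₁₃ hd.ne₁₃ hne with h1 | h1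
  · exact T.noncrossing _ _ _ _ h.2.1 h'.2.2 (crosses_of_ccw hc h1)
  · exact T.noncrossing _ _ _ _ h'.2.1 h.2.2 (crosses_of_ccw hd h1)

/-- If there are vertices strictly between `a` and `b`, then one of them is a neighbour of `a`, and
there is a last such neighbour. -/
theorem exists_last_neighbour (hx : Ccw a x b) :
    ∃ c, Ccw a c b ∧ T.graph.Adj a c ∧ ∀ y, Ccw a y b → T.graph.Adj a y → ¬ Ccw a c y := by
  have : IsTrans (Fin n) fun x y => Ccw a x y := ⟨fun _ _ _ => Ccw.trans⟩
  have : Std.Irrefl (α := Fin n) fun x y => Ccw a x y := ⟨fun _ h => h.ne₂₃ rfl⟩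
  have : IsTrans (Fin n) fun x y => Ccw a y x := ⟨fun _ _ _ h h' => h'.trans h⟩
  have : Std.Irrefl (α := Fin n) fun x y => Ccw a y x := ⟨fun _ h => h.ne₂₃ rfl⟩
  have wf := Finite.wellFounded_of_trans_of_irrefl (r := fun x y => Ccw a x y)
  have wf' := Finite.wellFounded_of_trans_of_irrefl (r := fun x y => Ccw a y x)
  -- `x₀` directly follows `a`, so nothing can cross the chord between them.
  obtain ⟨x₀, hx₀, hmin⟩ := wf.has_min {x | Ccw a x b} ⟨x, hx⟩
  have hadj : T.graph.Adj a x₀ := by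
    refine T.maximal _ _ hx₀.ne₁₂ fun c d _ hcr => ?_
    have : Ccw a c x₀ ∨ Ccw a d x₀ := by
      rcases hcr with h | h
      · exact Or.inl h.1
      · exact Or.inr h.1
    rcases this with h | h
    · exact hmin c (h.trans hx₀) h
    · exact hmin d (h.trans hx₀) h
  obtain ⟨c, ⟨hc, hac⟩, hmax⟩ := wf'.has_min {x | Ccw a x b ∧ T.graph.Adj a x} ⟨x₀, hx₀, hadj⟩
  exact ⟨c, hc, hac, fun y h h' => hmax y ⟨h, h'⟩⟩

/-- There is a triangle on each side of an arc on which there are vertices. -/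
theorem exists_triangle (hab : T.graph.Adj a b) (hx : Ccw a x b) :
    ∃ c, Ccw a c b ∧ T.graph.Adj a c ∧ T.graph.Adj c b := by
  obtain ⟨c, hc, hac, hmax⟩ := T.exists_last_neighbour hx
  refine ⟨c, hc, hac, T.maximal _ _ hc.ne₂₃ ?_⟩
  -- An arc crossing $cb$ would cross $ab$, cross $ac$, or end at $a$ and give a neighbour after the
  -- last one.
  have key : ∀ x y, T.graph.Adj x y → Ccw c x b → Ccw b y c → False := by
    intro x y hxy hx hy
    have h1 := T.noncrossing _ _ _ _ hab hxy
    have h2 := T.noncrossing _ _ _ _ hac hxy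
    obtain ⟨h3, h4⟩ := hx.ccw_and hc.rotate.rotate
    rcases hy.trichotomy hc.rotate.rotate with rfl | h5 | h5
    · exact hmax x h3 hxy.symm h4.rotate.rotate
    · exact h1 (Or.inl ⟨h3, h5⟩)
    · exact h2 (Or.inr ⟨h5, h4⟩)
  intro x y hxy hcr
  rcases hcr with h | h
  · exact key x y hxy h.1 h.2
  · exact key y x hxy.symm h.1 h.2

/-- Consecutive vertices of the polygon are joined by an arc. -/
theorem adj_of_not_ccw (hab : a ≠ b) (h : ∀ x, ¬ Ccw a x b) : T.graph.Adj a b :=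
  T.maximal _ _ hab fun c d _ hcr => by
    rcases hcr with h' | h'
    · exact h _ h'.1
    · exact h _ h'.1

variable {i j k l : Fin n}

/-- An arc from the far side of `jl` that lands on the side of `k` and crosses neither `jk` nor
`kl` ends at `k`. -/
theorem eq_of_crosses_aux (h : Ccw j k l) (hx : Ccw j x l) (hy : Ccw l y j)
    (n₁ : ¬ Crosses j k x y) (n₂ : ¬ Crosses k l x y) : x = k := by
  obtain ⟨h₁, h₂⟩ := hy.ccw_and h
  rcases hx.trichotomy h with h' | h' | h'
  · exact h'
  · exact absurd (Or.inl ⟨h', h₁⟩) n₁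
  · exact absurd (Or.inl ⟨h', h₂⟩) n₂

/-- Free of any triangulation, so that with the quadrilateral turned it also applies in
`exists_diagonal_flip` to a chord $xy$ that is not an arc. -/
theorem eq_of_crosses_quad (h₁ : Ccw j k l) (h₂ : Ccw l i j) (hxy : Crosses j l x y)
    (n₁ : ¬ Crosses i j x y) (n₂ : ¬ Crosses j k x y) (n₃ : ¬ Crosses k l x y)
    (n₄ : ¬ Crosses i l x y) : s(x, y) = s(i, k) := by
  have n₄' : ¬ Crosses l i x y := fun h => n₄ h.swap_left
  rw [Sym2.eq_iff]
  rcases hxy with h | h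
  · exact Or.inr ⟨eq_of_crosses_aux h₁ h.1 h.2 n₂ n₃,
      eq_of_crosses_aux h₂ h.2 h.1 (fun h => n₄' h.swap_right) (fun h => n₁ h.swap_right)⟩
  · exact Or.inl ⟨eq_of_crosses_aux h₂ h.2 h.1 n₄' n₁,
      eq_of_crosses_aux h₁ h.1 h.2 (fun h => n₂ h.swap_right) (fun h => n₃ h.swap_right)⟩

/-- The only arc that crosses the second diagonal of a quadrilateral is the first one. -/
theorem eq_of_crosses {T : PolygonTriangulation n} (h₁ : Ccw i j k) (h₂ : Ccw i k l)
    (t₁ : T.IsTriangle i j k) (t₂ : T.IsTriangle i k l) (hxy : T.graph.Adj x y)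
    (hcr : Crosses j l x y) : s(x, y) = s(i, k) :=
  eq_of_crosses_quad (h₁.rotate_quad h₂).1 (h₁.rotate_quad h₂).2 hcr
    (T.noncrossing _ _ _ _ t₁.1 hxy) (T.noncrossing _ _ _ _ t₁.2.2 hxy)
    (T.noncrossing _ _ _ _ t₂.2.2 hxy) (T.noncrossing _ _ _ _ t₂.2.1 hxy)

end PolygonTriangulation

/-- Matrices of size three over the Grassmann algebra. -/
abbrev GMat (K : Type*) [Field K] (V : Type*) [AddCommGroup V] [Module K V] : Type _ :=
  Matrix (Fin 3) (Fin 3) (ExteriorAlgebra K V)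

/-! ### Matrices preserving a (1,2)-entry up to sign. -/

section Stabilizer

variable {K : Type*} [Field K] {V : Type*} [AddCommGroup V] [Module K V]

/-- The matrices that preserve, up to sign, the first row of the matrices they are multiplied to
from the left, and the second column of those they are multiplied to from the right. -/
structure IsStabilizing (B : GMat K V) : Prop where
  h00 : B 0 0 = 1 ∨ B 0 0 = -1
  h01 : B 0 1 = 0
  h02 : B 0 2 = 0
  h11 : B 1 1 = 1 ∨ B 1 1 = -1
  h21 : B 2 1 = 0

theorem IsStabilizing.mul {B C : GMat K V} (hB : IsStabilizing B) (hC : IsStabilizing C) :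
    IsStabilizing (B * C) where
  h00 := by
    rcases hB.h00 with h | h <;> rcases hC.h00 with h' | h' <;>
      simp [Matrix.mul_apply, Fin.sum_univ_three, hB.h01, hB.h02, h, h']
  h01 := by simp [Matrix.mul_apply, Fin.sum_univ_three, hB.h01, hB.h02, hC.h01]
  h02 := by simp [Matrix.mul_apply, Fin.sum_univ_three, hB.h01, hB.h02, hC.h02]
  h11 := by
    rcases hB.h11 with h | h <;> rcases hC.h11 with h' | h' <;>
      simp [Matrix.mul_apply, Fin.sum_univ_three, hC.h01, hC.h21, h, h']
  h21 := by simp [Matrix.mul_apply, Fin.sum_univ_three, hB.h21, hC.h01, hC.h21]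

theorem IsStabilizing.of_mul_eq_one {B C : GMat K V} (hB : IsStabilizing B) (h : B * C = 1)
    (h' : C * B = 1) : IsStabilizing C := by
  have r : ∀ a, B 0 0 * C 0 a = (1 : GMat K V) 0 a := fun a => by
    rw [← h]; simp [Matrix.mul_apply, Fin.sum_univ_three, hB.h01, hB.h02]
  have c : ∀ a, C a 1 * B 1 1 = (1 : GMat K V) a 1 := fun a => by
    rw [← h']; simp [Matrix.mul_apply, Fin.sum_univ_three, hB.h01, hB.h21]
  have r0 := r 0
  have r1 := r 1
  have r2 := r 2
  have c1 := c 1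
  have c2 := c 2
  constructor
  · rcases hB.h00 with h | h <;> simp only [h, Matrix.one_apply_eq, one_mul, neg_mul] at r0
    · exact Or.inl r0
    · exact Or.inr (neg_eq_iff_eq_neg.mp r0)
  · rcases hB.h00 with h | h <;> simpa [h] using r1
  · rcases hB.h00 with h | h <;> simpa [h] using r2
  · rcases hB.h11 with h | h <;> simp only [h, Matrix.one_apply_eq, mul_one, mul_neg] at c1
    · exact Or.inl c1
    · exact Or.inr (neg_eq_iff_eq_neg.mp c1)
  · rcases hB.h11 with h | h <;> simpa [h] using c2

variable (K V) in
/-- The group of stabilizing matrices. -/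
def stabilizing : Subgroup (GMat K V)ˣ where
  carrier := {B | IsStabilizing B.val}
  one_mem' := by constructor <;> simp
  mul_mem' := fun ha hb => by
    simp only [Set.mem_ofPred_eq, Units.val_mul] at *
    exact ha.mul hb
  inv_mem' := fun {B} ha => by
    simp only [Set.mem_ofPred_eq] at *
    exact ha.of_mul_eq_one B.mul_inv B.inv_mul

theorem entry_of_stabilizing {B H C : GMat K V} (hB : IsStabilizing B) (hC : IsStabilizing C) :
    (B * H * C) 0 1 = H 0 1 ∨ (B * H * C) 0 1 = -H 0 1 := by
  have h : (B * H * C) 0 1 = B 0 0 * H 0 1 * C 1 1 := by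
    simp [Matrix.mul_apply, Fin.sum_univ_three, hB.h01, hB.h02, hC.h01, hC.h21]
  rw [h]
  rcases hB.h00 with h | h <;> rcases hC.h11 with h' | h' <;> simp [h, h']

/-- The entry at `(0, 1)` is determined up to sign by the cosets of the stabilizing group. -/
theorem entry_eq_of_mem {g g' r r' : (GMat K V)ˣ} (hg : g * r⁻¹ ∈ stabilizing K V)
    (hg' : g' * r'⁻¹ ∈ stabilizing K V) :
    (g * g'⁻¹).val 0 1 = (r * r'⁻¹).val 0 1 ∨ (g * g'⁻¹).val 0 1 = -(r * r'⁻¹).val 0 1 := by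
  have h : g * g'⁻¹ = (g * r⁻¹) * (r * r'⁻¹) * (g' * r'⁻¹)⁻¹ := by group
  rw [h, Units.val_mul, Units.val_mul]
  exact entry_of_stabilizing hg (inv_mem hg')

variable (K V) in
/-- The fermionic reflection as a unit. -/
def rhoUnit : (GMat K V)ˣ where
  val := matRho
  inv := matRho
  val_inv := by
    ext a b
    fin_cases a <;> fin_cases b <;> simp [matRho, Matrix.mul_apply, Fin.sum_univ_three]
  inv_val := by
    ext a b
    fin_cases a <;> fin_cases b <;> simp [matRho, Matrix.mul_apply, Fin.sum_univ_three]

@[simp] theorem rhoUnit_val : (rhoUnit K V).val = matRho := rfl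

@[simp] theorem matRho_mul_matRho : (matRho : GMat K V) * matRho = 1 := (rhoUnit K V).mul_inv

@[simp] theorem rhoUnit_mul_rhoUnit : rhoUnit K V * rhoUnit K V = 1 := Units.ext matRho_mul_matRho

theorem rhoUnit_mem : rhoUnit K V ∈ stabilizing K V := by
  change IsStabilizing (matRho : GMat K V)
  constructor <;> simp [matRho]

theorem isStabilizing_shearMat (h m : ExteriorAlgebra K V) : IsStabilizing (shearMat h m) := by
  constructor <;> simp [shearMat]

/-- The origin of the sign in `corner_k`. -/
theorem matRho_mul_shearMat (h m : ExteriorAlgebra K V) :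
    matRho * shearMat h m = shearMat h (-m) * matRho := by
  ext a b
  fin_cases a <;> fin_cases b <;>
    simp [matRho, shearMat, Matrix.mul_apply, Fin.sum_univ_three]

theorem shearMat_mul_neg {h m : ExteriorAlgebra K V} (hm : m * m = 0) :
    shearMat h m * shearMat (-h) (-m) = 1 := by
  rw [shearMat_mul, mul_neg, hm, ← shearMat_zero]; simp

theorem shearMat_neg_mul {h m : ExteriorAlgebra K V} (hm : m * m = 0) :
    shearMat (-h) (-m) * shearMat h m = 1 := by
  rw [shearMat_mul, neg_mul, hm, ← shearMat_zero]; simp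

theorem matRho_mul_matE (x : ExteriorAlgebra K V) : matRho * matE x = matE x * matRho := by
  ext a b
  fin_cases a <;> fin_cases b <;>
    simp [matRho, matE, Matrix.mul_apply, Fin.sum_univ_three]

theorem matE_mul_matE {x : ExteriorAlgebra K V} (hx : IsUnit x) :
    matE x * matE x = matRho := by
  ext a b
  fin_cases a <;> fin_cases b <;>
    simp [matRho, matE, Matrix.mul_apply, Fin.sum_univ_three, Ring.mul_inverse_cancel _ hx,
      Ring.inverse_mul_cancel _ hx]

theorem Ring.inverse_neg' {R : Type*} [Ring R] (x : R) : Ring.inverse (-x) = -Ring.inverse x := by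
  by_cases hx : IsUnit x
  · obtain ⟨u, rfl⟩ := hx
    rw [← Units.val_neg, Ring.inverse_unit, Ring.inverse_unit, ← Units.val_neg]
    simp
  · rw [Ring.inverse_non_unit _ hx, Ring.inverse_non_unit _ (by simpa using hx), neg_zero]

theorem matE_neg_mul {x : ExteriorAlgebra K V} (hx : IsUnit x) : matE (-x) * matE x = 1 := by
  ext a b
  fin_cases a <;> fin_cases b <;>
    simp [matE, Matrix.mul_apply, Fin.sum_univ_three, Ring.mul_inverse_cancel _ hx,
      Ring.inverse_mul_cancel _ hx, Ring.inverse_neg']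

theorem isUnit_matE {x : ExteriorAlgebra K V} (hx : IsUnit x) : IsUnit (matE x) := by
  have h : matE x * (matE x * matRho) = 1 := by
    rw [← mul_assoc, matE_mul_matE hx, matRho_mul_matRho]
  have h' : matE x * matRho * matE x = 1 := by
    rw [mul_assoc, matRho_mul_matE, ← mul_assoc, matE_mul_matE hx, matRho_mul_matRho]
  exact ⟨⟨_, _, h, h'⟩, rfl⟩

theorem EvenPart.inverse_eq {a b : EvenPart K V} (h : a * b = 1) :
    Ring.inverse a.1 = b.1 := by
  have h' : b * a = 1 := by rw [mul_comm, h]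
  exact Ring.inverse_unit
    (⟨a.1, b.1, congrArg Subtype.val h, congrArg Subtype.val h'⟩ : (ExteriorAlgebra K V)ˣ)

end Stabilizer

/-! ### Connection matrices and their flatness. -/

namespace SuperDecoration

variable {K : Type*} [Field K] [LinearOrder K] {V : Type*} [AddCommGroup V] [Module K V] {n : ℕ}

/-- The odd entry `√h μ` of the matrix at the corner `i` of the triangle `ijk`. -/
noncomputable def oddEntry (D : SuperDecoration K V n) (i j k : Fin n) : ExteriorAlgebra K V :=
  superSqrt (D.hLength i j k) * D.mu i j k

/-- The matrix of the clockwise edge at the angle `i` of the triangle `ijk`. -/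
noncomputable def angleMat (D : SuperDecoration K V n) (i j k : Fin n) : GMat K V :=
  shearMat (D.hLength i j k) (D.oddEntry i j k)

open Classical in
/-- The matrix of the edge that crosses the arc `ab` near `a`. -/
noncomputable def crossUnit (D : SuperDecoration K V n) (a b : Fin n) : (GMat K V)ˣ :=
  if D.orient a b then 1 else rhoUnit K V

variable (D : SuperDecoration K V n) {a b c : Fin n}

theorem crossUnit_mem (a b : Fin n) : D.crossUnit a b ∈ stabilizing K V := by
  unfold crossUnit
  split_ifs
  · exact one_mem _
  · exact rhoUnit_mem

@[simp] theorem crossUnit_mul_self (a b : Fin n) : D.crossUnit a b * D.crossUnit a b = 1 := by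
  unfold crossUnit
  split_ifs <;> simp

theorem crossUnit_mul_swap (h : D.graph.Adj a b) :
    D.crossUnit b a * D.crossUnit a b = rhoUnit K V := by
  unfold crossUnit
  rcases D.orient_xor a b h with ⟨h1, h2⟩ | ⟨h1, h2⟩ <;> simp [h1, h2]

theorem crossUnit_mul_matE (a b : Fin n) (x : ExteriorAlgebra K V) :
    (D.crossUnit a b).val * matE x = matE x * (D.crossUnit a b).val := by
  unfold crossUnit
  split_ifs
  · simp
  · exact matRho_mul_matE x

-- Trivial monodromy around the square across an arc: the two crossing edges contribute $\rho$, and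
-- the two parallel edges $E^2=\rho$. One direction of each arc therefore suffices for the side
-- condition.
variable {D} in
theorem side_symm [IsStrictOrderedRing K] (h : D.graph.Adj a b) {g g' : GMat K V}
    (hg : matE (D.lam a b) * (D.crossUnit a b).val * g = g') :
    matE (D.lam b a) * (D.crossUnit b a).val * g' = g := by
  have hu := (D.lam_pos a b h).isUnit
  have hX : (D.crossUnit b a).val * (D.crossUnit a b).val = matRho :=
    congrArg Units.val (D.crossUnit_mul_swap h)
  rw [← hg, ← D.lam_symm a b h]
  calc matE (D.lam a b) * (D.crossUnit b a).val *
        (matE (D.lam a b) * (D.crossUnit a b).val * g)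
      = matE (D.lam a b) * ((D.crossUnit b a).val * matE (D.lam a b)) *
        (D.crossUnit a b).val * g := by simp only [mul_assoc]
    _ = matE (D.lam a b) * matE (D.lam a b) *
        ((D.crossUnit b a).val * (D.crossUnit a b).val) * g := by
          rw [crossUnit_mul_matE]; simp only [mul_assoc]
    _ = g := by rw [hX, matE_mul_matE hu, matRho_mul_matRho, one_mul]

section Corners

variable [IsStrictOrderedRing K]

variable {D}

theorem hLength_pos (t : D.IsTriangle a b c) : IsPos (D.hLength a b c) :=
  (D.lam_pos _ _ t.2.2).mul ((D.lam_pos _ _ t.1).mul (D.lam_pos _ _ t.2.1)).inverse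

theorem oddEntry_odd (hK : ∀ x : K, 0 ≤ x → IsSquare x) (t : D.IsTriangle a b c) :
    IsOdd (D.oddEntry a b c) :=
  (superSqrt_spec hK (hLength_pos t)).1.1.mul_odd (D.mu_odd _ _ _ t)

theorem isUnit_angleMat (hK : ∀ x : K, 0 ≤ x → IsSquare x) (t : D.IsTriangle a b c) :
    IsUnit (D.angleMat a b c) :=
  have h := (oddEntry_odd hK t).mul_self
  ⟨⟨_, _, shearMat_mul_neg h, shearMat_neg_mul h⟩, rfl⟩

theorem isTriangleCorner {x y z : EvenPart K V} (hx : IsPos x.1)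
    (hy : IsPos y.1) (hz : IsPos z.1) (hab : x.1 * x.1 = D.lam a b) (hac : y.1 * y.1 = D.lam a c)
    (hbc : z.1 * z.1 = D.lam b c) :
    IsTriangleCorner x y z (D.mu a b c) (D.hLength a b c) (D.oddEntry a b c) := by
  -- `w` inverts $xy$; then $zw$ is positive with square $h$, hence equals $\sqrt h$.
  obtain ⟨w, hw⟩ := (hx.mul hy).isUnit_even.exists_right_inv
  replace hw : x * y * w = 1 := hw
  have hwpos : IsPos w.1 := EvenPart.inverse_eq hw ▸ (hx.mul hy).inverse
  have hh : D.hLength a b c = (z * w * (z * w) : EvenPart K V).1 := by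
    rw [hLength, ← hab, ← hac, ← hbc]
    have : Ring.inverse (x.1 * x.1 * (y.1 * y.1)) = (w * w).1 :=
      EvenPart.inverse_eq (a := x * x * (y * y)) (by linear_combination (x * y * w + 1) * hw)
    rw [this]
    exact congrArg Subtype.val (by ring : z * z * (w * w) = z * w * (z * w))
  have hs : superSqrt (D.hLength a b c) = (z * w).1 := superSqrt_eq (hz.mul hwpos) hh.symm
  constructor
  · rw [hh]
    change (x * x * (y * y) * (z * w * (z * w)) : EvenPart K V).1 = (z * z : EvenPart K V).1 * 1
    rw [mul_one]
    exact congrArg Subtype.val (by linear_combination z * z * (x * y * w + 1) * hw)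
  · rw [oddEntry, hs]
    change (x * y) • (z * w) • D.mu a b c = z • D.mu a b c
    rw [smul_smul]
    exact congrArg (· • D.mu a b c) (by linear_combination z * hw)

theorem exists_root (hK : ∀ x : K, 0 ≤ x → IsSquare x) {x : ExteriorAlgebra K V} (hx : IsPos x) :
    ∃ r : EvenPart K V, IsPos r.1 ∧ r.1 * r.1 = x := by
  obtain ⟨y, hy, h⟩ := hx.exists_sqrt hK
  exact ⟨⟨y, hy.1⟩, hy, h⟩

theorem _root_.IsTriangleCorner.swap {R Λ : Type*} [CommRing R] [Ring Λ] [Algebra R Λ] {x y z : R}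
    {μ h m : Λ} (H : IsTriangleCorner x y z μ h m) : IsTriangleCorner y x z μ h m :=
  ⟨by rw [mul_comm]; exact H.even, by rw [mul_comm]; exact H.odd⟩

/-- If the matrices of five edges of a hexagon match the values at its corners, then so does the
sixth. -/
theorem hexagon_closes (hK : ∀ x : K, 0 ≤ x → IsSquare x) (t : D.IsTriangle a b c)
    {Gab Gba Gbc Gcb Gca Gac : GMat K V}
    (h₁ : D.angleMat b c a * Gbc = Gba) (h₂ : matE (D.lam b a) * Gba = Gab)
    (h₃ : D.angleMat a b c * Gab = Gac) (h₄ : matE (D.lam a c) * Gac = Gca)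
    (h₅ : matE (D.lam c b) * Gcb = Gbc) : D.angleMat c a b * Gca = Gcb := by
  -- Roots for the sides opposite to `a`, `b`, `c`, in this order.
  obtain ⟨x, hx, hbc⟩ := exists_root hK (D.lam_pos _ _ t.2.2)
  obtain ⟨y, hy, hca⟩ := exists_root hK (D.lam_pos _ _ t.2.1.symm)
  obtain ⟨z, hz, hab⟩ := exists_root hK (D.lam_pos _ _ t.1)
  have sab := D.lam_symm _ _ t.1
  have sac := D.lam_symm _ _ t.2.1
  have sbc := D.lam_symm _ _ t.2.2
  have ca := (isTriangleCorner hz hy hx hab (hca.trans sac.symm) hbc).swap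
  have cb := (isTriangleCorner hx hz hy hbc (hab.trans sab) hca).swap
  have cc := (isTriangleCorner hy hx hz hca (hbc.trans sbc) hab).swap
  rw [← D.mu_rotate _ _ _ t] at cb
  rw [← D.mu_rotate _ _ _ t.rotate, ← D.mu_rotate _ _ _ t] at cc
  have hinv : ∀ {w : EvenPart K V}, IsPos w.1 → (w * w) • Ring.inverse (w.1 * w.1) = 1 :=
    fun {w} hw => Ring.mul_inverse_cancel _ (hw.mul hw).isUnit
  have hsq : ∀ w : EvenPart K V, (w * w) • (1 : ExteriorAlgebra K V) = w.1 * w.1 :=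
    fun w => mul_one (w.1 * w.1)
  have key := hexagon_monodromy hx.isUnit_even hy.isUnit_even hz.isUnit_even
    (D.mu_odd _ _ _ t).mul_self ca cb cc (hinv hx) (hinv hy) (hinv hz)
  rw [hsq, hsq, hsq, hbc, hca, hab] at key
  have key' : matE (D.lam b c) * D.angleMat c a b * matE (D.lam c a) * D.angleMat a b c *
      matE (D.lam a b) * D.angleMat b c a = 1 := key
  rw [← sab] at h₂
  rw [sac] at h₄
  rw [← sbc] at h₅
  rw [← (isUnit_matE (D.lam_pos _ _ t.2.2).isUnit).mul_right_inj, h₅, ← h₄, ← h₃, ← h₂, ← h₁]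
  simpa only [mul_assoc, one_mul] using congrArg (· * Gbc) key'

end Corners

end SuperDecoration

/-! ### Cutting a polygon along a triangle. -/

namespace PolygonTriangulation

variable {n : ℕ} {T : PolygonTriangulation n} {a b c x y z : Fin n}

/-- An arc with ends on both sides of $c$ crosses $ac$ or $cb$ unless it is $ab$. -/
theorem arc_cases (hac : a < c) (hcb : c < b) (tac : T.graph.Adj a c) (tcb : T.graph.Adj c b)
    (hx : x ∈ Set.Icc a b) (hy : y ∈ Set.Icc a b) (hxy : T.graph.Adj x y) :
    (x = a ∧ y = b) ∨ (x = b ∧ y = a) ∨ (x ≤ c ∧ y ≤ c) ∨ (c ≤ x ∧ c ≤ y) := by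
  have key : ∀ x y, x ∈ Set.Icc a b → y ∈ Set.Icc a b → T.graph.Adj x y → x < c → c < y →
      x = a ∧ y = b := by
    intro x y hx hy hxy h1 h2
    rw [Set.mem_Icc] at hx hy
    constructor
    · by_contra hne
      have h3 : a < x := lt_of_le_of_ne hx.1 (Ne.symm hne)
      exact T.noncrossing _ _ _ _ tac hxy
        (Or.inl ⟨ccw_of_lt h3 h1, (ccw_of_lt hac h2).rotate⟩)
    · by_contra hne
      have h3 : y < b := lt_of_le_of_ne hy.2 hne
      exact T.noncrossing _ _ _ _ tcb hxy
        (Or.inr ⟨ccw_of_lt h2 h3, (ccw_of_lt h1 hcb).rotate.rotate⟩)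
  rcases le_or_gt x c with h1 | h1 <;> rcases le_or_gt y c with h2 | h2
  · exact Or.inr (Or.inr (Or.inl ⟨h1, h2⟩))
  · rcases eq_or_lt_of_le h1 with rfl | h1
    · exact Or.inr (Or.inr (Or.inr ⟨le_rfl, h2.le⟩))
    · exact Or.inl (key x y hx hy hxy h1 h2)
  · rcases eq_or_lt_of_le h2 with rfl | h2
    · exact Or.inr (Or.inr (Or.inr ⟨h1.le, le_rfl⟩))
    · exact Or.inr (Or.inl (key y x hy hx hxy.symm h2 h1).symm)
  · exact Or.inr (Or.inr (Or.inr ⟨h1.le, h2.le⟩))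

/-- `arc_cases` sorts each side. The side $ab$ can occur only as $b\to a$, all vertices lying on one
side of it, and then the third vertex is $c$. -/
theorem triangle_cases (hac : a < c) (hcb : c < b) (t : T.IsTriangle a c b)
    (hx : x ∈ Set.Icc a b) (hy : y ∈ Set.Icc a b) (hz : z ∈ Set.Icc a b) (h : T.IsTriangle x y z)
    (hc : Ccw x y z) :
    (x ≤ c ∧ y ≤ c ∧ z ≤ c) ∨ (c ≤ x ∧ c ≤ y ∧ c ≤ z) ∨ (x = a ∧ y = c ∧ z = b) ∨
      (x = c ∧ y = b ∧ z = a) ∨ (x = b ∧ y = a ∧ z = c) := by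
  have key : ∀ x y z, x ∈ Set.Icc a b → y ∈ Set.Icc a b → z ∈ Set.Icc a b → T.IsTriangle x y z →
      Ccw x y z → (x = b ∧ y = a ∧ z = c) ∨ (x ≤ c ∧ y ≤ c) ∨ (c ≤ x ∧ c ≤ y) := by
    intro x y z hx hy hz h hc
    rcases arc_cases hac hcb t.1 t.2.2 hx hy h.1 with ⟨rfl, rfl⟩ | ⟨rfl, rfl⟩ | h' | h'
    · exfalso
      rw [Set.mem_Icc] at hz
      simp only [Ccw, Fin.lt_def, Fin.le_def] at *; omega
    · exact Or.inl ⟨rfl, rfl, h.unique t.rotate.rotate hc (ccw_of_lt hac hcb).rotate.rotate⟩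
    · exact Or.inr (Or.inl h')
    · exact Or.inr (Or.inr h')
  have nxy := h.1.ne
  have nxz := h.2.1.ne
  have nyz := h.2.2.ne
  have k1 := key x y z hx hy hz h hc
  have k2 := key y z x hy hz hx h.rotate hc.rotate
  have k3 := key z x y hz hx hy h.rotate.rotate hc.rotate.rotate
  simp only [Fin.ext_iff, Fin.le_def, ne_eq, Fin.lt_def] at *
  omega

end PolygonTriangulation

/-! ### Existence of a potential. -/

namespace SuperDecoration

variable {K : Type*} [Field K] [LinearOrder K] [IsStrictOrderedRing K]
  {V : Type*} [AddCommGroup V] [Module K V] {n : ℕ}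

/-- Values `g a b` at the corners near `a` and to the left of the arc `ab`, for `a`, `b` in `S`,
that are compatible with parallel transport. Up to the stabilizing group, `g a b` agrees
with `R a`. -/
structure IsPotentialOn (D : SuperDecoration K V n) (S : Set (Fin n)) (R : Fin n → (GMat K V)ˣ)
    (g : Fin n → Fin n → (GMat K V)ˣ) : Prop where
  side : ∀ a ∈ S, ∀ b ∈ S, D.graph.Adj a b →
    matE (D.lam a b) * (D.crossUnit a b).val * (g a b).val = (g b a).val
  angle : ∀ a ∈ S, ∀ b ∈ S, ∀ c ∈ S, D.IsTriangle a b c → Ccw a b c →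
    D.angleMat a b c * (g a b).val = (D.crossUnit a c).val * (g a c).val
  coset : ∀ a ∈ S, ∀ b ∈ S, D.graph.Adj a b → g a b * (R a)⁻¹ ∈ stabilizing K V

variable {D : SuperDecoration K V n} {a b c : Fin n}

/-- Angle and crossing matrices are stabilizing, so cosets can be carried around a polygon vertex.
-/
theorem coset_iff_of_angle (hK : ∀ x : K, 0 ≤ x → IsSquare x) (t : D.IsTriangle a b c)
    {g g' r : (GMat K V)ˣ}
    (h : D.angleMat a b c * g.val = (D.crossUnit a c).val * g'.val) :
    g * r⁻¹ ∈ stabilizing K V ↔ g' * r⁻¹ ∈ stabilizing K V := by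
  obtain ⟨A, hA⟩ := isUnit_angleMat hK t
  have hA' : A ∈ stabilizing K V := by
    change IsStabilizing A.val
    rw [hA]; exact isStabilizing_shearMat _ _
  have h' : A * g = D.crossUnit a c * g' := Units.ext (by simpa [hA] using h)
  have hg : g = A⁻¹ * D.crossUnit a c * g' := by rw [mul_assoc, ← h']; group
  have hX := D.crossUnit_mem a c
  rw [hg, mul_assoc]
  exact Subgroup.mul_mem_cancel_left _ (mul_mem (inv_mem hA') hX)

/-- Induction over the subpolygon cut off by $ab$; the value `M` is prescribed so that pieces can be
glued. The triangle on $ab$ splits off two smaller pieces. Its two angle edges at $a$ and $c$ are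
used to choose values, and the one at $b$ closes by flatness of the hexagon. -/
theorem exists_potentialOn_Icc (hK : ∀ x : K, 0 ≤ x → IsSquare x) (D : SuperDecoration K V n)
    (m : ℕ) : ∀ a b : Fin n, b.val - a.val ≤ m → a < b → D.graph.Adj a b → ∀ M : (GMat K V)ˣ,
      ∃ R g, D.IsPotentialOn (Set.Icc a b) R g ∧ g a b = M := by
  induction m with
  | zero => intro a b h1 h2; rw [Fin.lt_def] at h2; omega
  | succ m ih =>
    intro a b hm hlt hab M
    obtain ⟨E, hE⟩ := isUnit_matE (D.lam_pos a b hab).isUnit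
    by_cases hbt : ∃ x, Ccw a x b
    · obtain ⟨w, hw⟩ := hbt
      obtain ⟨c, hc, tac, tcb⟩ := D.exists_triangle hab hw
      clear hw w
      have hlts : a < c ∧ c < b := by
        simp only [Ccw, Fin.lt_def] at *; omega
      obtain ⟨hac, hcb⟩ := hlts
      have t : D.IsTriangle a c b := ⟨tac, hab, tcb⟩
      obtain ⟨A, hA⟩ := isUnit_angleMat hK t
      obtain ⟨C, hC⟩ := isUnit_angleMat hK t.rotate
      have hac_val := Fin.lt_def.mp hac
      have hcb_val := Fin.lt_def.mp hcb
      -- The prescribed values are those forced by the angle edges at `a` and then at `c`.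
      obtain ⟨R₁, g₁, P₁, hg₁⟩ := ih a c (by omega) hac tac (A⁻¹ * (D.crossUnit a b * M))
      obtain ⟨R₂, g₂, P₂, hg₂⟩ := ih c b (by omega) hcb tcb (C⁻¹ * (D.crossUnit c a * g₁ c a))
      have hac' : a ∈ Set.Icc a c := ⟨le_rfl, hac.le⟩
      have hcc' : c ∈ Set.Icc a c := ⟨hac.le, le_rfl⟩
      have hcc'' : c ∈ Set.Icc c b := ⟨le_rfl, hcb.le⟩
      have hbc'' : b ∈ Set.Icc c b := ⟨hcb.le, le_rfl⟩
      have ang_a : D.angleMat a c b * (g₁ a c).val = (D.crossUnit a b).val * M.val := by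
        rw [hg₁, ← hA]; simp
      have ang_c : D.angleMat c b a * (g₂ c b).val = (D.crossUnit c a).val * (g₁ c a).val := by
        rw [hg₂, ← hC]; simp
      have ang_b : D.angleMat b a c * (E * (D.crossUnit a b * M)).val =
          (D.crossUnit b c).val * (g₂ b c).val := by
        refine hexagon_closes hK t ang_c (Gab := (g₁ a c).val) ?_ ang_a ?_ ?_
        · rw [← mul_assoc]; exact P₁.side c hcc' a hac' tac.symm
        · simp [hE]
        · rw [← mul_assoc]; exact P₂.side b hbc'' c hcc'' tcb.symm
      let g : Fin n → Fin n → (GMat K V)ˣ := fun x y =>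
        if x = a ∧ y = b then M else if x = b ∧ y = a then E * (D.crossUnit a b * M) else
          if x ≤ c ∧ y ≤ c then g₁ x y else g₂ x y
      -- The pieces share `c`, where `R₁` is kept; the values of `g₂` near `c` are moved into its
      -- coset through the angle edge at `c`.
      let R : Fin n → (GMat K V)ˣ := fun x => if x ≤ c then R₁ x else R₂ x
      have gab : g a b = M := by simp [g]
      have gba : g b a = E * (D.crossUnit a b * M) := by simp [g, hlt.ne']
      have g1 : ∀ x y, x ≤ c → y ≤ c → g x y = g₁ x y := by
        intro x y hx hy
        have h1 : x ≠ b := by rintro rfl; exact absurd hx (not_le.mpr hcb)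
        have h2 : y ≠ b := by rintro rfl; exact absurd hy (not_le.mpr hcb)
        simp [g, h1, h2, hx, hy]
      have g2 : ∀ x y, c ≤ x → c ≤ y → x ≠ y → g x y = g₂ x y := by
        intro x y hx hy hne
        have h1 : x ≠ a := by rintro rfl; exact absurd hx (not_le.mpr hac)
        have h2 : y ≠ a := by rintro rfl; exact absurd hy (not_le.mpr hac)
        have h3 : ¬ (x ≤ c ∧ y ≤ c) := fun h => hne ((h.1.antisymm hx).trans (h.2.antisymm hy).symm)
        simp [g, h1, h2, h3]
      refine ⟨R, g, ⟨?_, ?_, ?_⟩, gab⟩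
      · intro x hx y hy hxy
        rcases PolygonTriangulation.arc_cases hac hcb tac tcb hx hy hxy with
          ⟨rfl, rfl⟩ | ⟨rfl, rfl⟩ | ⟨h1, h2⟩ | ⟨h1, h2⟩
        · rw [gab, gba]; simp [hE, mul_assoc]
        · refine side_symm hab ?_
          rw [gab, gba]; simp [hE, mul_assoc]
        · rw [g1 _ _ h1 h2, g1 _ _ h2 h1]
          exact P₁.side x ⟨hx.1, h1⟩ y ⟨hy.1, h2⟩ hxy
        · rw [g2 _ _ h1 h2 hxy.ne, g2 _ _ h2 h1 hxy.ne']
          exact P₂.side x ⟨h1, hx.2⟩ y ⟨h2, hy.2⟩ hxy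
      · intro x hx y hy z hz txyz hxyz
        rcases PolygonTriangulation.triangle_cases hac hcb t hx hy hz txyz hxyz with
          ⟨h1, h2, h3⟩ | ⟨h1, h2, h3⟩ | ⟨rfl, rfl, rfl⟩ | ⟨rfl, rfl, rfl⟩ | ⟨rfl, rfl, rfl⟩
        · rw [g1 _ _ h1 h2, g1 _ _ h1 h3]
          exact P₁.angle x ⟨hx.1, h1⟩ y ⟨hy.1, h2⟩ z ⟨hz.1, h3⟩ txyz hxyz
        · rw [g2 _ _ h1 h2 txyz.1.ne, g2 _ _ h1 h3 txyz.2.1.ne]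
          exact P₂.angle x ⟨h1, hx.2⟩ y ⟨h2, hy.2⟩ z ⟨h3, hz.2⟩ txyz hxyz
        · rw [g1 _ _ hac.le le_rfl, gab]; exact ang_a
        · rw [g2 _ _ le_rfl hcb.le hcb.ne, g1 _ _ le_rfl hac.le]; exact ang_c
        · rw [g2 _ _ hcb.le le_rfl hcb.ne', gba]; exact ang_b
      · intro x hx y hy hxy
        rcases PolygonTriangulation.arc_cases hac hcb tac tcb hx hy hxy with
          ⟨rfl, rfl⟩ | ⟨rfl, rfl⟩ | ⟨h1, h2⟩ | ⟨h1, h2⟩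
        · rw [gab, show R x = R₁ x from if_pos hac.le, ← coset_iff_of_angle hK t ang_a]
          exact P₁.coset _ hac' _ hcc' tac
        · rw [gba, show R x = R₂ x from if_neg (not_le.mpr hcb),
            coset_iff_of_angle hK t.rotate.rotate ang_b]
          exact P₂.coset _ hbc'' _ hcc'' tcb.symm
        · rw [g1 _ _ h1 h2, show R x = R₁ x from if_pos h1]
          exact P₁.coset x ⟨hx.1, h1⟩ y ⟨hy.1, h2⟩ hxy
        · rw [g2 _ _ h1 h2 hxy.ne]
          have hP := P₂.coset x ⟨h1, hx.2⟩ y ⟨h2, hy.2⟩ hxy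
          rcases eq_or_lt_of_le h1 with rfl | h1
          · rw [show R c = R₁ c from if_pos le_rfl]
            have h3 := P₁.coset _ hcc' _ hac' tac.symm
            rw [← coset_iff_of_angle hK t.rotate ang_c] at h3
            have h4 := P₂.coset _ hcc'' _ hbc'' tcb
            have h5 := mul_mem (mul_mem hP (inv_mem h4)) h3
            convert h5 using 1
            group
          · rwa [show R x = R₂ x from if_neg (not_le.mpr h1)]
    · have hS : ∀ x ∈ Set.Icc a b, x = a ∨ x = b := by
        intro x hx
        by_contra hne
        rw [not_or] at hne
        exact hbt ⟨x, ccw_of_lt (lt_of_le_of_ne hx.1 (Ne.symm hne.1)) (lt_of_le_of_ne hx.2 hne.2)⟩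
      let g : Fin n → (GMat K V)ˣ := fun x => if x = a then M else E * (D.crossUnit a b * M)
      have ga : g a = M := if_pos rfl
      have gb : g b = E * (D.crossUnit a b * M) := if_neg hlt.ne'
      have hside : matE (D.lam a b) * (D.crossUnit a b).val * (g a).val = (g b).val := by
        rw [ga, gb]; simp [hE, mul_assoc]
      -- With two vertices there is one value near each, serving as its own representative.
      refine ⟨g, fun x _ => g x, ⟨?_, ?_, ?_⟩, ga⟩
      · intro x hx y hy hxy
        rcases hS x hx with rfl | rfl <;> rcases hS y hy with rfl | rfl
        · exact absurd rfl hxy.ne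
        · exact hside
        · exact side_symm hab hside
        · exact absurd rfl hxy.ne
      · intro x hx y hy z hz txyz
        exfalso
        have n1 := txyz.1.ne
        have n2 := txyz.2.1.ne
        have n3 := txyz.2.2.ne
        rcases hS x hx with rfl | rfl <;> rcases hS y hy with rfl | rfl <;>
          rcases hS z hz with rfl | rfl <;> contradiction
      · intro x hx y hy hxy
        simp

/-- Every decoration of a polygon has a potential. -/
theorem exists_potential (hK : ∀ x : K, 0 ≤ x → IsSquare x) (D : SuperDecoration K V n) :
    ∃ R g, D.IsPotentialOn Set.univ R g := by
  rcases lt_or_ge n 2 with hn | hn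
  · have h : ∀ a b : Fin n, a = b := fun a b => Fin.ext (by omega)
    exact ⟨1, 1, fun a _ b _ hab => absurd (h a b) hab.ne, fun a _ b _ c _ t => absurd (h a b) t.1.ne,
      fun a _ b _ hab => absurd (h a b) hab.ne⟩
  · let a : Fin n := ⟨0, by omega⟩
    let b : Fin n := ⟨n - 1, by omega⟩
    have hab : a < b := by rw [Fin.lt_def]; simp only [a, b]; omega
    -- The side joining the last vertex to the first cuts off the whole polygon.
    have h : D.graph.Adj b a := D.adj_of_not_ccw hab.ne' fun x hx => by
      have := x.isLt
      simp only [Ccw, Fin.lt_def, a, b] at hx; omega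
    obtain ⟨R, g, hP, -⟩ := exists_potentialOn_Icc hK D _ a b le_rfl hab h.symm 1
    have hS : Set.Icc a b = Set.univ := by
      ext x
      simp only [Set.mem_Icc, Set.mem_univ, iff_true, Fin.le_def, a, b]
      have := x.isLt
      omega
    exact ⟨R, g, hS ▸ hP⟩

end SuperDecoration

/-! ### Transport of a potential through a flip. -/

namespace SuperDecoration

variable {K : Type*} [Field K] [LinearOrder K] {V : Type*} [AddCommGroup V] [Module K V] {n : ℕ}

namespace IsFlip

variable {D D' : SuperDecoration K V n} {i j k l : Fin n}

section Combinatorics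

variable (F : D.IsFlip D' i j k l)

include F

theorem ccw_jkl : Ccw j k l := (F.ccw_left.rotate_quad F.ccw_right).1

theorem ccw_ijl : Ccw i j l := (F.ccw_left.rotate_quad F.ccw_right).2.rotate

theorem adj_of_ne {a b : Fin n} (h : D.graph.Adj a b) (h' : s(a, b) ≠ s(i, k)) :
    D'.graph.Adj a b :=
  (F.adj_iff a b).mpr (Or.inl ⟨h, h'⟩)

theorem adj_old {a b : Fin n} (h : D'.graph.Adj a b) (h' : s(a, b) ≠ s(j, l)) :
    D.graph.Adj a b :=
  (((F.adj_iff a b).mp h).resolve_right h').1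

theorem adj_jl : D'.graph.Adj j l := (F.adj_iff j l).mpr (Or.inr rfl)

theorem ne_all : i ≠ j ∧ i ≠ k ∧ i ≠ l ∧ j ≠ k ∧ j ≠ l ∧ k ≠ l :=
  ⟨F.ccw_left.ne₁₂, F.ccw_left.ne₁₃, F.ccw_right.ne₁₃, F.ccw_left.ne₂₃, F.ccw_jkl.ne₁₃,
    F.ccw_right.ne₂₃⟩

theorem triangle_jkl : D'.IsTriangle j k l := by
  obtain ⟨h1, h2, h3, h4, h5, h6⟩ := F.ne_all
  exact ⟨F.adj_of_ne F.triangle_left.2.2 (by simp [h1.symm, h4]), F.adj_jl,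
    F.adj_of_ne F.triangle_right.2.2 (by simp [h3.symm, h2.symm])⟩

theorem triangle_ijl : D'.IsTriangle i j l := by
  obtain ⟨h1, h2, h3, h4, h5, h6⟩ := F.ne_all
  exact ⟨F.adj_of_ne F.triangle_left.1 (by simp [h2, h4]),
    F.adj_of_ne F.triangle_right.2.1 (by simp [h6.symm, h2]), F.adj_jl⟩

/-- A triangle on the left of the new diagonal or of its inverse. -/
theorem eq_of_triangle {x : Fin n} (t : D'.IsTriangle j l x) :
    (x = i ∧ Ccw j l x) ∨ (x = k ∧ Ccw l j x) := by
  rcases t.ccw_or with h | h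
  · exact Or.inl ⟨t.unique F.triangle_ijl.rotate h F.ccw_ijl.rotate, h⟩
  · exact Or.inr ⟨t.swap.unique F.triangle_jkl.rotate.rotate h.rotate.rotate
      F.ccw_jkl.rotate.rotate, h.rotate.rotate⟩

theorem triangle_cases {x y z : Fin n} (t : D'.IsTriangle x y z) (h : Ccw x y z) :
    (s(x, y) ≠ s(j, l) ∧ s(x, z) ≠ s(j, l) ∧ s(y, z) ≠ s(j, l)) ∨
      (x = j ∧ y = k ∧ z = l) ∨ (x = k ∧ y = l ∧ z = j) ∨ (x = l ∧ y = j ∧ z = k) ∨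
      (x = i ∧ y = j ∧ z = l) ∨ (x = j ∧ y = l ∧ z = i) ∨ (x = l ∧ y = i ∧ z = j) := by
  by_cases h1 : s(x, y) = s(j, l)
  · rcases Sym2.eq_iff.mp h1 with ⟨rfl, rfl⟩ | ⟨rfl, rfl⟩
    · rcases F.eq_of_triangle t with ⟨rfl, -⟩ | ⟨rfl, h'⟩
      · simp
      · exact absurd h' h.rotate.not_swap
    · rcases F.eq_of_triangle t.swap with ⟨rfl, h'⟩ | ⟨rfl, -⟩
      · exact absurd h' h.rotate.not_swap
      · simp
  by_cases h2 : s(x, z) = s(j, l)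
  · rcases Sym2.eq_iff.mp h2 with ⟨rfl, rfl⟩ | ⟨rfl, rfl⟩
    · rcases F.eq_of_triangle t.swap_right with ⟨rfl, h'⟩ | ⟨rfl, -⟩
      · exact absurd h' h.not_swap
      · simp
    · rcases F.eq_of_triangle t.swap_right.swap with ⟨rfl, -⟩ | ⟨rfl, h'⟩
      · simp
      · exact absurd h' h.not_swap
  by_cases h3 : s(y, z) = s(j, l)
  · rcases Sym2.eq_iff.mp h3 with ⟨rfl, rfl⟩ | ⟨rfl, rfl⟩
    · rcases F.eq_of_triangle t.rotate with ⟨rfl, -⟩ | ⟨rfl, h'⟩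
      · simp
      · exact absurd h'.rotate.rotate h.not_swap
    · rcases F.eq_of_triangle t.rotate.swap with ⟨rfl, h'⟩ | ⟨rfl, -⟩
      · exact absurd h'.rotate.rotate h.not_swap
      · simp
  exact Or.inl ⟨h1, h2, h3⟩

theorem triangle_old {x y z : Fin n} (t : D'.IsTriangle x y z)
    (h : s(x, y) ≠ s(j, l) ∧ s(x, z) ≠ s(j, l) ∧ s(y, z) ≠ s(j, l)) : D.IsTriangle x y z :=
  ⟨F.adj_old t.1 h.1, F.adj_old t.2.1 h.2.1, F.adj_old t.2.2 h.2.2⟩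

theorem angleMat_old {x y z : Fin n} (t : D'.IsTriangle x y z)
    (h : s(x, y) ≠ s(j, l) ∧ s(x, z) ≠ s(j, l) ∧ s(y, z) ≠ s(j, l)) :
    D'.angleMat x y z = D.angleMat x y z := by
  simp only [angleMat, oddEntry, hLength, F.lam_other _ _ t.1 h.1, F.lam_other _ _ t.2.1 h.2.1,
    F.lam_other _ _ t.2.2 h.2.2, F.mu_other _ _ _ t h.1 h.2.1 h.2.2]

theorem crossUnit_other {a b : Fin n} (h : D'.graph.Adj a b) (h₁ : s(a, b) ≠ s(j, l))
    (h₂ : s(a, b) ≠ s(k, l)) : D'.crossUnit a b = D.crossUnit a b := by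
  have := F.orient_other a b h h₁ h₂
  by_cases ho : D.orient a b <;> simp [crossUnit, this, ho]

theorem crossUnit_jl : D'.crossUnit j l = 1 := by
  simp [crossUnit, F.orient_new]

theorem crossUnit_ik : D.crossUnit i k = 1 := by
  simp [crossUnit, F.orient_old]

theorem crossUnit_ki : D.crossUnit k i = rhoUnit K V := by
  have h := D.crossUnit_mul_swap F.triangle_left.2.1
  rwa [F.crossUnit_ik, mul_one] at h

/-- Reversing $kl$ makes up for the $\rho$ lost at $k$ with the old diagonal. -/
theorem crossUnit_kl : D'.crossUnit k l * rhoUnit K V = D.crossUnit k l := by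
  rcases D.orient_xor k l F.triangle_right.2.2 with ⟨h1, h2⟩ | ⟨h1, h2⟩ <;>
    simp [crossUnit, F.orient_rev, h1, h2]

end Combinatorics

section Matrices

variable [IsStrictOrderedRing K] (hK : ∀ x : K, 0 ≤ x → IsSquare x) (F : D.IsFlip D' i j k l)

include hK F

/-- Positive roots of all $\lambda$-lengths turn the flip formulas into the polynomial relations of
`SuperPtolemy`. -/
theorem angleMat_relations :
    D'.angleMat i j l = D.angleMat i k l * D.angleMat i j k ∧
    D'.angleMat k l j = D.angleMat k i j * shearMat (D.hLength k l i) (-D.oddEntry k l i) ∧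
    D.angleMat j k i = D'.angleMat j l i * D'.angleMat j k l := by
  have tl := F.triangle_left
  have tr := F.triangle_right
  obtain ⟨n1, n2, n3, n4, n5, n6⟩ := F.ne_all
  obtain ⟨p, hp, ha⟩ := exists_root hK (D.lam_pos _ _ tr.2.1)
  obtain ⟨q, hq, hb⟩ := exists_root hK (D.lam_pos _ _ tr.2.2)
  obtain ⟨r, hr, hc⟩ := exists_root hK (D.lam_pos _ _ tl.2.2)
  obtain ⟨s, hs, hd⟩ := exists_root hK (D.lam_pos _ _ tl.1)
  obtain ⟨u, hu, he⟩ := exists_root hK (D.lam_pos _ _ tl.2.1)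
  obtain ⟨v, hv, hf⟩ := exists_root hK (D'.lam_pos _ _ F.adj_jl)
  obtain ⟨t, ht, htt⟩ := exists_root hK
    (((D.lam_pos _ _ tr.2.1).mul (D.lam_pos _ _ tl.2.2)).add
      ((D.lam_pos _ _ tr.2.2).mul (D.lam_pos _ _ tl.1)))
  have sq_mul : ∀ {x y : EvenPart K V}, IsPos x.1 → IsPos y.1 →
      superSqrt (x.1 * x.1 * (y.1 * y.1)) = (x * y).1 := fun {x y} hx hy =>
    superSqrt_eq (hx.mul hy) (congrArg Subtype.val (by ring : x * y * (x * y) = x * x * (y * y)))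
  have st := superSqrt_eq ht htt
  have tinv : ∀ x : ExteriorAlgebra K V, t • (x * Ring.inverse t.1) = x := fun x => by
    change t.1 * (x * Ring.inverse t.1) = x
    rw [(ht.1.commute _).eq, mul_assoc, Ring.inverse_mul_cancel _ ht.isUnit, mul_one]
  have comm : ∀ (x : EvenPart K V) (y : ExteriorAlgebra K V), y * x.1 = x • y := fun x y =>
    (IsEven.commute x.2 y).eq.symm
  have P : SuperPtolemy p q r s u v t (D.mu i j k) (D.mu i k l) (D'.mu i j l) (D'.mu j k l) :=
    { hp := hp.isUnit_even
      hq := hq.isUnit_even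
      hr := hr.isUnit_even
      hs := hs.isUnit_even
      hu := hu.isUnit_even
      hv := hv.isUnit_even
      ht := ht.isUnit_even
      huvt := ((hu.mul hv).add ht).isUnit_even
      t_sq := Subtype.ext (by
        change t.1 * t.1 = p.1 * p.1 * (r.1 * r.1) + q.1 * q.1 * (s.1 * s.1)
        rw [htt, ha, hb, hc, hd])
      σσ := (D.mu_odd _ _ _ tl).mul_self
      θθ := (D.mu_odd _ _ _ tr).mul_self
      θσ := (D.mu_odd _ _ _ tr).mul_eq_neg (D.mu_odd _ _ _ tl)
      uv_sq := by
        have h4 : superSqrt (D.lam i l * D.lam k l * D.lam j k * D.lam i j) = (p * q * r * s).1 :=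
          superSqrt_eq (((hp.mul hq).mul hr).mul hs) (by
            rw [← ha, ← hb, ← hc, ← hd]
            exact congrArg Subtype.val
              (by ring : p * q * r * s * (p * q * r * s) = p * p * (q * q) * (r * r) * (s * s)))
        have h := F.lam_new
        rw [h4, ← htt, ← he, ← hf, mul_assoc (p * q * r * s).1] at h
        change u.1 * u.1 * (v.1 * v.1) * 1 = t.1 * t.1 * 1 + (p * q * r * s).1 * _
        rw [mul_one, mul_one, h]
      left := by
        have h := F.mu_left
        rw [st, ← ha, ← hb, ← hc, ← hd, sq_mul hq hs, sq_mul hp hr, comm, comm] at h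
        rw [h, tinv]
      right := by
        have h := F.mu_right
        rw [st, ← ha, ← hb, ← hc, ← hd, sq_mul hq hs, sq_mul hp hr, comm, comm] at h
        rw [h, tinv] }
  have hd' : s.1 * s.1 = D'.lam i j := by
    rw [hd, F.lam_other _ _ F.triangle_ijl.1 (by simp [n1, n3])]
  have ha' : p.1 * p.1 = D'.lam i l := by
    rw [ha, F.lam_other _ _ F.triangle_ijl.2.1 (by simp [n1, n3])]
  have hc' : r.1 * r.1 = D'.lam j k := by
    rw [hc, F.lam_other _ _ F.triangle_jkl.1 (by simp [n5, n6])]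
  have hb' : q.1 * q.1 = D'.lam k l := by
    rw [hb, F.lam_other _ _ F.triangle_jkl.2.2 (by simp [n4.symm, n6])]
  have sy := fun {a b} h => D.lam_symm a b h
  have sy' := fun {a b} h => D'.lam_symm a b h
  have tL := F.triangle_ijl
  have tR := F.triangle_jkl
  refine ⟨P.corner_i (isTriangleCorner hs hp hv hd' ha' hf)
    (isTriangleCorner hu hp hq he ha hb) (isTriangleCorner hs hu hr hd he hc),
    P.corner_k ?_ ?_ ?_, P.corner_j ?_ ?_ ?_⟩
  · rw [D'.mu_rotate _ _ _ tR]
    exact isTriangleCorner hq hr hv hb' (hc'.trans (sy' tR.1)) (hf.trans (sy' tR.2.1))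
  · rw [D.mu_rotate _ _ _ tl, D.mu_rotate _ _ _ tl.rotate]
    exact isTriangleCorner hu hr hs (he.trans (sy tl.2.1)) (hc.trans (sy tl.2.2)) hd
  · rw [D.mu_rotate _ _ _ tr]
    exact isTriangleCorner hq hu hp hb (he.trans (sy tr.1)) (ha.trans (sy tr.2.1))
  · rw [D.mu_rotate _ _ _ tl]
    exact isTriangleCorner hr hs hu hc (hd.trans (sy tl.1)) (he.trans (sy tl.2.1))
  · rw [D'.mu_rotate _ _ _ tL]
    exact isTriangleCorner hv hs hp hf (hd'.trans (sy' tL.1)) (ha'.trans (sy' tL.2.1))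
  · exact isTriangleCorner hr hv hq hc' hf hb'

/-- A flip preserves the cosets of the values of a potential. -/
theorem exists_potential {R : Fin n → (GMat K V)ˣ} {g : Fin n → Fin n → (GMat K V)ˣ}
    (P : D.IsPotentialOn Set.univ R g) : ∃ g', D'.IsPotentialOn Set.univ R g' := by
  obtain ⟨rel_i, rel_k, rel_j⟩ := F.angleMat_relations hK
  have tl := F.triangle_left
  have tr := F.triangle_right
  have tL := F.triangle_ijl
  have tR := F.triangle_jkl
  obtain ⟨n1, n2, n3, n4, n5, n6⟩ := F.ne_all
  have side := fun {a b} h => P.side a trivial b trivial h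
  have angle := fun {a b c} t h => P.angle a trivial b trivial c trivial t h
  obtain ⟨A, hA⟩ := isUnit_angleMat hK tR
  obtain ⟨E, hE⟩ := isUnit_matE (D'.lam_pos _ _ F.adj_jl).isUnit
  -- The values on $jl$ are forced by the angle $jkl$ and the side condition; the value on $kl$
  -- absorbs the $\rho$ formerly met at $k$.
  let g' : Fin n → Fin n → (GMat K V)ˣ := fun x y =>
    if x = j ∧ y = l then A * g j k else if x = l ∧ y = j then E * (A * g j k) else
      if x = k ∧ y = l then rhoUnit K V * g k l else g x y
  have gjl : g' j l = A * g j k := by simp [g']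
  have glj : g' l j = E * (A * g j k) := by simp [g', n5, n5.symm]
  have gkl : g' k l = rhoUnit K V * g k l := by simp [g', n4.symm, n5.symm, n6]
  have gother : ∀ {x y}, s(x, y) ≠ s(j, l) → ¬ (x = k ∧ y = l) → g' x y = g x y := by
    intro x y h1 h2
    rw [ne_eq, Sym2.eq_iff, not_or] at h1
    simp only [g', if_neg h1.1, if_neg h1.2, if_neg h2]
  -- Beyond $kl$ nothing changes: the factor $\rho$ and the reversed orientation cancel.
  have gkl' : (D'.crossUnit k l).val * (g' k l).val = (D.crossUnit k l).val * (g k l).val := by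
    rw [gkl, ← F.crossUnit_kl]; simp [mul_assoc]
  have nkl : s(k, l) ≠ s(j, l) := by simp [n4.symm, n6]
  have glk : g' l k = g l k := gother (by rw [Sym2.eq_swap]; exact nkl) (by simp [n6.symm])
  have side_kl : matE (D'.lam k l) * (D'.crossUnit k l).val * (g' k l).val = (g' l k).val := by
    rw [mul_assoc, gkl', F.lam_other _ _ tR.2.2 nkl, glk, ← mul_assoc]
    exact side tr.2.2
  have side_jl : matE (D'.lam j l) * (D'.crossUnit j l).val * (g' j l).val = (g' l j).val := by
    rw [gjl, glj, F.crossUnit_jl]; simp [hE]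
  have side' : ∀ {x y}, D'.graph.Adj x y →
      matE (D'.lam x y) * (D'.crossUnit x y).val * (g' x y).val = (g' y x).val := by
    intro x y hxy
    by_cases h1 : s(x, y) = s(j, l)
    · rcases Sym2.eq_iff.mp h1 with ⟨rfl, rfl⟩ | ⟨rfl, rfl⟩
      · exact side_jl
      · exact side_symm hxy.symm side_jl
    by_cases h2 : s(x, y) = s(k, l)
    · rcases Sym2.eq_iff.mp h2 with ⟨rfl, rfl⟩ | ⟨rfl, rfl⟩
      · exact side_kl
      · exact side_symm hxy.symm side_kl
    rw [F.lam_other _ _ hxy h1, F.crossUnit_other hxy h1 h2,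
      gother h1 (fun h => h2 (Sym2.eq_iff.mpr (Or.inl h))),
      gother (by rwa [Sym2.eq_swap]) (fun h => h2 (Sym2.eq_iff.mpr (Or.inr h.symm)))]
    exact side (F.adj_old hxy h1)
  have side'' : ∀ {x y}, D'.graph.Adj x y →
      matE (D'.lam x y) * ((D'.crossUnit x y).val * (g' x y).val) = (g' y x).val := fun h => by
    rw [← mul_assoc]; exact side' h
  have same : ∀ {x y}, D'.graph.Adj x y → s(x, y) ≠ s(j, l) → ¬ (x = l ∧ y = k) →
      (D'.crossUnit x y).val * (g' x y).val = (D.crossUnit x y).val * (g x y).val := by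
    intro x y hxy h1 h2
    by_cases h3 : x = k ∧ y = l
    · obtain ⟨rfl, rfl⟩ := h3
      exact gkl'
    · rw [gother h1 h3, F.crossUnit_other hxy h1 fun h => (Sym2.eq_iff.mp h).elim h3 h2]
  have gij : g' i j = g i j := gother (by simp [n1, n3]) (by simp [n2])
  have gjk : g' j k = g j k := gother (by simp [n5, n6]) (by simp [n4])
  have angle_jkl : D'.angleMat j k l * (g' j k).val = (D'.crossUnit j l).val * (g' j l).val := by
    rw [gjk, gjl, F.crossUnit_jl]; simp [hA]
  have angle_klj : D'.angleMat k l j * (g' k l).val = (D'.crossUnit k j).val * (g' k j).val := by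
    have h1 := angle tr.rotate F.ccw_right.rotate
    have h2 := angle tl.rotate.rotate F.ccw_left.rotate.rotate
    rw [same tR.1.symm (by simp [n4.symm, n6]) (by simp [n6]), ← h2, rel_k, gkl,
      mul_assoc]
    congr 1
    rw [Units.val_mul, ← mul_assoc, rhoUnit_val, ← matRho_mul_shearMat, mul_assoc]
    change matRho * (D.angleMat k l i * _) = _
    rw [h1, F.crossUnit_ki, rhoUnit_val, ← mul_assoc, matRho_mul_matRho, one_mul]
  have angle_ijl : D'.angleMat i j l * (g' i j).val = (D'.crossUnit i l).val * (g' i l).val := by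
    rw [same tL.2.1 (by simp [n1, n3]) (by simp [n3]), rel_i, gij, mul_assoc,
      angle tl F.ccw_left, F.crossUnit_ik, ← angle tr F.ccw_right]
    simp
  have angle_jli : D'.angleMat j l i * (g' j l).val = (D'.crossUnit j i).val * (g' j i).val := by
    rw [same tL.1.symm (by simp [n1, n3]) (by simp [n5]),
      ← angle tl.rotate F.ccw_left.rotate, rel_j, gjl, Units.val_mul, hA, mul_assoc]
  -- At `l` each new hexagon already has five compatible edges.
  have angle_ljk : D'.angleMat l j k * (g' l j).val = (D'.crossUnit l k).val * (g' l k).val :=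
    hexagon_closes hK tR angle_klj (side'' tR.1.symm) angle_jkl (side'' tR.2.1)
      (side'' tR.2.2.symm)
  have angle_lij : D'.angleMat l i j * (g' l i).val = (D'.crossUnit l j).val * (g' l j).val :=
    hexagon_closes hK tL angle_jli (side'' tL.1.symm) angle_ijl (side'' tL.2.1)
      (side'' tL.2.2.symm)
  refine ⟨g', fun x _ y _ h => side' h, ?_, ?_⟩
  · intro x _ y _ z _ t h
    rcases F.triangle_cases t h with h' | ⟨rfl, rfl, rfl⟩ | ⟨rfl, rfl, rfl⟩ | ⟨rfl, rfl, rfl⟩ |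
      ⟨rfl, rfl, rfl⟩ | ⟨rfl, rfl, rfl⟩ | ⟨rfl, rfl, rfl⟩
    · rw [F.angleMat_old t h', same t.2.1 h'.2.1, gother h'.1]
      · exact angle (F.triangle_old t h') h
      -- The triangle to the left of $kl$ is $jkl$, so an old triangle never meets the modified
      -- value.
      · rintro ⟨rfl, rfl⟩
        obtain rfl := t.unique tR.rotate h F.ccw_jkl.rotate
        exact h'.2.2 Sym2.eq_swap
      · rintro ⟨rfl, rfl⟩
        obtain rfl := t.rotate.rotate.unique tR.rotate h.rotate.rotate F.ccw_jkl.rotate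
        exact h'.1 Sym2.eq_swap
    · exact angle_jkl
    · exact angle_klj
    · exact angle_ljk
    · exact angle_ijl
    · exact angle_jli
    · exact angle_lij
  · intro x _ y _ hxy
    have old := fun {a b} h => P.coset a trivial b trivial h
    by_cases h1 : s(x, y) = s(j, l)
    · rcases Sym2.eq_iff.mp h1 with ⟨rfl, rfl⟩ | ⟨rfl, rfl⟩
      · rw [← coset_iff_of_angle hK tR angle_jkl, gjk]
        exact old tl.2.2
      · rw [coset_iff_of_angle hK tR.rotate.rotate angle_ljk, glk]
        exact old tr.2.2.symm
    by_cases h2 : x = k ∧ y = l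
    · obtain ⟨rfl, rfl⟩ := h2
      rw [gkl, mul_assoc]
      exact mul_mem rhoUnit_mem (old tr.2.2)
    · rw [gother h1 h2]
      exact old (F.adj_old hxy h1)

end Matrices

end IsFlip

end SuperDecoration

/-! ### Connectedness of $\Gamma_T$. -/

namespace GammaVertex

variable {n : ℕ} {T : PolygonTriangulation n}

theorem reachable_swap_right {a b c : Fin n} (t : T.IsTriangle a b c) :
    (gammaGraph T).Reachable ⟨a, b, c, t⟩ ⟨a, c, b, t.swap_right⟩ :=
  SimpleGraph.Adj.reachable (Or.inl ⟨rfl, rfl, rfl⟩)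

theorem reachable_swap {a b c : Fin n} (t : T.IsTriangle a b c) :
    (gammaGraph T).Reachable ⟨a, b, c, t⟩ ⟨b, a, c, t.swap⟩ :=
  SimpleGraph.Adj.reachable (Or.inr (Or.inl ⟨rfl, rfl, rfl⟩))

theorem reachable_rotate {a b c : Fin n} (t : T.IsTriangle a b c) :
    (gammaGraph T).Reachable ⟨a, b, c, t⟩ ⟨b, c, a, t.rotate⟩ :=
  (reachable_swap t).trans (reachable_swap_right t.swap)

theorem reachable_cross {a b c d : Fin n} (t : T.IsTriangle a b c) (t' : T.IsTriangle a b d)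
    (h : d ≠ c) : (gammaGraph T).Reachable ⟨a, b, c, t⟩ ⟨a, b, d, t'⟩ :=
  SimpleGraph.Adj.reachable (Or.inr (Or.inr ⟨rfl, rfl, h⟩))

/-- The induction of `exists_potentialOn_Icc` again: every corner is joined to the triangle on $ab$,
through the next triangle beyond $ac$ or $cb$ where needed. -/
theorem reachable_of_mem_Icc (m : ℕ) : ∀ a b : Fin n, b.val - a.val ≤ m → a < b → T.graph.Adj a b →
    ∀ v w : GammaVertex T, v.near ∈ Set.Icc a b → v.side ∈ Set.Icc a b → v.opp ∈ Set.Icc a b →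
      w.near ∈ Set.Icc a b → w.side ∈ Set.Icc a b → w.opp ∈ Set.Icc a b →
        (gammaGraph T).Reachable v w := by
  induction m with
  | zero => intro a b h1 h2; rw [Fin.lt_def] at h2; omega
  | succ m ih =>
    intro a b hm hlt hab v w hv₁ hv₂ hv₃ hw₁ hw₂ hw₃
    have between : ∀ {a b : Fin n} {v : GammaVertex T}, v.near ∈ Set.Icc a b →
        v.side ∈ Set.Icc a b → v.opp ∈ Set.Icc a b → ∃ x, Ccw a x b := by
      intro a b v h1 h2 h3
      have n1 := v.isTriangle.1.ne
      have n2 := v.isTriangle.2.1.ne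
      have n3 := v.isTriangle.2.2.ne
      have : Ccw a v.near b ∨ Ccw a v.side b ∨ Ccw a v.opp b := by
        simp only [Set.mem_Icc, Ccw, Fin.lt_def, Fin.le_def, ne_eq, Fin.ext_iff] at *; omega
      rcases this with h | h | h
      exacts [⟨_, h⟩, ⟨_, h⟩, ⟨_, h⟩]
    obtain ⟨x, hx⟩ := between hv₁ hv₂ hv₃
    obtain ⟨c, hc, tac, tcb⟩ := T.exists_triangle hab hx
    have hlts : a < c ∧ c < b := by
      simp only [Ccw, Fin.lt_def] at *; omega
    obtain ⟨hac, hcb⟩ := hlts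
    have hac_val := Fin.lt_def.mp hac
    have hcb_val := Fin.lt_def.mp hcb
    have t : T.IsTriangle a c b := ⟨tac, hab, tcb⟩
    have key : ∀ v : GammaVertex T, v.near ∈ Set.Icc a b → v.side ∈ Set.Icc a b →
        v.opp ∈ Set.Icc a b → (gammaGraph T).Reachable ⟨a, c, b, t⟩ v := by
      intro v h1 h2 h3
      have left : v.near ≤ c → v.side ≤ c → v.opp ≤ c →
          (gammaGraph T).Reachable ⟨a, c, b, t⟩ v := by
        intro l1 l2 l3
        obtain ⟨y, hy⟩ := between ⟨h1.1, l1⟩ ⟨h2.1, l2⟩ ⟨h3.1, l3⟩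
        obtain ⟨d, hd, tad, tdc⟩ := T.exists_triangle tac hy
        have hlts : a < d ∧ d < c := by
          simp only [Ccw, Fin.lt_def] at *; omega
        have t' : T.IsTriangle a c d := ⟨tac, tad, tdc.symm⟩
        exact (reachable_cross t t' (hlts.2.trans hcb).ne).trans
          (ih a c (by omega) hac tac ⟨a, c, d, t'⟩ v ⟨le_rfl, hac.le⟩ ⟨hac.le, le_rfl⟩
            ⟨hlts.1.le, hlts.2.le⟩ ⟨h1.1, l1⟩ ⟨h2.1, l2⟩ ⟨h3.1, l3⟩)
      have right : c ≤ v.near → c ≤ v.side → c ≤ v.opp →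
          (gammaGraph T).Reachable ⟨a, c, b, t⟩ v := by
        intro l1 l2 l3
        obtain ⟨y, hy⟩ := between ⟨l1, h1.2⟩ ⟨l2, h2.2⟩ ⟨l3, h3.2⟩
        obtain ⟨d, hd, tcd, tdb⟩ := T.exists_triangle tcb hy
        have hlts : c < d ∧ d < b := by
          simp only [Ccw, Fin.lt_def] at *; omega
        have t' : T.IsTriangle c b d := ⟨tcb, tcd, tdb.symm⟩
        exact ((reachable_rotate t).trans (reachable_cross t.rotate t' (hac.trans hlts.1).ne')).trans
          (ih c b (by omega) hcb tcb ⟨c, b, d, t'⟩ v ⟨le_rfl, hcb.le⟩ ⟨hcb.le, le_rfl⟩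
            ⟨hlts.1.le, hlts.2.le⟩ ⟨l1, h1.2⟩ ⟨l2, h2.2⟩ ⟨l3, h3.2⟩)
      rcases v with ⟨x, y, z, tv⟩
      rcases tv.ccw_or with h | h
      · rcases PolygonTriangulation.triangle_cases hac hcb t h1 h2 h3 tv h with
          ⟨l1, l2, l3⟩ | ⟨l1, l2, l3⟩ | ⟨rfl, rfl, rfl⟩ | ⟨rfl, rfl, rfl⟩ | ⟨rfl, rfl, rfl⟩
        · exact left l1 l2 l3
        · exact right l1 l2 l3
        · exact SimpleGraph.Reachable.refl _
        · exact reachable_rotate t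
        · exact (reachable_rotate t).trans (reachable_rotate t.rotate)
      · rcases PolygonTriangulation.triangle_cases hac hcb t h1 h3 h2 tv.swap_right h with
          ⟨l1, l2, l3⟩ | ⟨l1, l2, l3⟩ | ⟨rfl, rfl, rfl⟩ | ⟨rfl, rfl, rfl⟩ | ⟨rfl, rfl, rfl⟩
        · exact left l1 l3 l2
        · exact right l1 l3 l2
        · exact reachable_swap_right t
        · exact reachable_swap t
        · exact ((reachable_rotate t).trans (reachable_rotate t.rotate)).trans
            (reachable_swap_right t.rotate.rotate)
    exact (key v hv₁ hv₂ hv₃).symm.trans (key w hw₁ hw₂ hw₃)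

/-- The graph `Γ_T` is connected. -/
theorem reachable (v w : GammaVertex T) : (gammaGraph T).Reachable v w := by
  have n1 := v.isTriangle.1.ne
  have h1 := v.near.isLt
  have h2 := v.side.isLt
  rw [ne_eq, Fin.ext_iff] at n1
  let a : Fin n := ⟨0, by omega⟩
  let b : Fin n := ⟨n - 1, by omega⟩
  have hab : a < b := by rw [Fin.lt_def]; simp only [a, b]; omega
  have h : T.graph.Adj b a := T.adj_of_not_ccw hab.ne' fun x hx => by
    have := x.isLt
    simp only [Ccw, Fin.lt_def, a, b] at hx; omega
  have hS : ∀ x : Fin n, x ∈ Set.Icc a b := fun x => by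
    have := x.isLt
    simp only [Set.mem_Icc, Fin.le_def, a, b]; omega
  exact reachable_of_mem_Icc _ a b le_rfl hab h.symm v w (hS _) (hS _) (hS _) (hS _) (hS _) (hS _)

end GammaVertex

/-! ### Holonomies and $\lambda$-lengths from a potential. -/

namespace SuperDecoration

variable {K : Type*} [Field K] [LinearOrder K] {V : Type*} [AddCommGroup V] [Module K V] {n : ℕ}

open Classical in
/-- The value of a potential at a vertex of `Γ_T`. -/
noncomputable def cornerValue (D : SuperDecoration K V n) (g : Fin n → Fin n → (GMat K V)ˣ)
    (v : GammaVertex D.toPolygonTriangulation) : (GMat K V)ˣ :=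
  if Ccw v.near v.side v.opp then g v.near v.side
  else D.crossUnit v.near v.side * g v.near v.side

variable {D : SuperDecoration K V n} {R : Fin n → (GMat K V)ˣ}
  {g : Fin n → Fin n → (GMat K V)ˣ}

theorem matAInv_eq (h θ : ExteriorAlgebra K V) :
    matAInv h θ = shearMat (-h) (-(superSqrt h * θ)) := by
  simp [matAInv, shearMat]

theorem angleMat_swap {a b c : Fin n} (t : D.IsTriangle a b c) :
    D.hLength a b c = D.hLength a c b ∧ D.mu a b c = D.mu a c b := by
  constructor
  · rw [hLength, hLength, D.lam_symm b c t.2.2, ((D.lam_pos _ _ t.1).1.commute _).eq]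
  · rw [D.mu_rotate _ _ _ t, D.mu_swap _ _ _ t.rotate, D.mu_rotate _ _ _ t.rotate.swap,
      D.mu_rotate _ _ _ t.rotate.swap.rotate]

open Classical in
theorem crossUnit_val (D : SuperDecoration K V n) (a b : Fin n) :
    (D.crossUnit a b).val = if D.orient a b then 1 else matRho := by
  unfold crossUnit
  split_ifs <;> rfl

/-- A potential records clockwise edges only; counterclockwise ones use the inverse matrices, and
crossings in either direction use that crossing matrices are involutions. -/
theorem edgeMatrix_mul [IsStrictOrderedRing K] (hK : ∀ x : K, 0 ≤ x → IsSquare x) (P : D.IsPotentialOn Set.univ R g)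
    {v w : GammaVertex D.toPolygonTriangulation}
    (h : (gammaGraph D.toPolygonTriangulation).Adj v w) :
    D.edgeMatrix v w * (D.cornerValue g v).val = (D.cornerValue g w).val := by
  obtain ⟨a, b, c, t⟩ := v
  obtain ⟨a', b', c', t'⟩ := w
  have hXX : ∀ (x y : Fin n) (M : GMat K V),
      (D.crossUnit x y).val * ((D.crossUnit x y).val * M) = M := fun x y M => by
    rw [← mul_assoc, ← Units.val_mul, crossUnit_mul_self, Units.val_one, one_mul]
  rcases h with ⟨h1, h2, h3⟩ | ⟨h1, h2, h3⟩ | ⟨h1, h2, h3⟩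
  · dsimp only at h1 h2 h3
    subst h1 h2 h3
    rw [edgeMatrix, if_pos ⟨rfl, rfl, rfl⟩]
    by_cases hc : Ccw a' c' b'
    · simp only [cornerValue, if_pos hc, if_neg hc.not_swap, Units.val_mul]
      exact P.angle _ trivial _ trivial _ trivial t hc
    · have hc' := t.ccw_or.resolve_left hc
      simp only [cornerValue, if_neg hc, if_pos hc', Units.val_mul]
      have hodd := (oddEntry_odd hK t.swap_right).mul_self
      rw [(angleMat_swap t).1, (angleMat_swap t).2, matAInv_eq,
        ← P.angle _ trivial _ trivial _ trivial t.swap_right hc', ← mul_assoc]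
      change shearMat _ (-D.oddEntry _ _ _) * shearMat _ (D.oddEntry _ _ _) * _ = _
      rw [shearMat_neg_mul hodd, one_mul]
  · dsimp only at h1 h2 h3
    subst h1 h2 h3
    rw [edgeMatrix, if_neg (fun h => t.1.ne h.1.symm), if_pos ⟨rfl, rfl, rfl⟩]
    have hside := P.side _ trivial _ trivial t.1
    by_cases hc : Ccw b' c' a'
    · simp only [cornerValue, if_pos hc, if_neg hc.not_swap, if_pos hc.rotate.rotate,
        Units.val_mul]
      rw [← hside, mul_assoc]
    · have hc' := t.ccw_or.resolve_right hc
      simp only [cornerValue, if_neg hc, if_pos hc', if_neg hc'.rotate.not_swap,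
        Units.val_mul]
      have hu := (D.lam_pos _ _ t.1).isUnit
      rw [← P.side _ trivial _ trivial t.1.symm, ← D.lam_symm _ _ t.1, ← mul_assoc, ← mul_assoc,
        matE_neg_mul hu, one_mul]
  · dsimp only at h1 h2 h3
    subst h1 h2
    rw [edgeMatrix, if_neg (fun h => t.2.2.ne h.2.1), if_neg (fun h => t.1.ne h.1)]
    have hX := D.crossUnit_val a' b'
    by_cases hc : Ccw a' b' c
    · have hc' : ¬ Ccw a' b' c' := fun h => h3 (t'.unique t h hc)
      simp only [cornerValue, if_pos hc, if_neg hc', Units.val_mul]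
      rw [hX]
    · have hc' : Ccw a' b' c' := by
        by_contra h
        exact h3 (t'.swap.unique t.swap (t'.ccw_or.resolve_left h).rotate.rotate
          (t.ccw_or.resolve_left hc).rotate.rotate)
      simp only [cornerValue, if_neg hc, if_pos hc', Units.val_mul]
      rw [← hX, hXX]

theorem holonomy_eq [IsStrictOrderedRing K] (hK : ∀ x : K, 0 ≤ x → IsSquare x) (P : D.IsPotentialOn Set.univ R g)
    {v w : GammaVertex D.toPolygonTriangulation}
    (p : (gammaGraph D.toPolygonTriangulation).Walk v w) :
    D.holonomy p = (D.cornerValue g w * (D.cornerValue g v)⁻¹).val := by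
  have h : D.holonomy p * (D.cornerValue g v).val = (D.cornerValue g w).val := by
    induction p with
    | nil => simp [holonomy]
    | cons h p ih => rw [holonomy, mul_assoc, edgeMatrix_mul hK P h, ih]
  rw [Units.val_mul, ← h, mul_assoc, ← Units.val_mul, mul_inv_cancel, Units.val_one, mul_one]

theorem cornerValue_coset (P : D.IsPotentialOn Set.univ R g)
    (v : GammaVertex D.toPolygonTriangulation) :
    D.cornerValue g v * (R v.near)⁻¹ ∈ stabilizing K V := by
  have h := P.coset _ trivial _ trivial v.isTriangle.1
  unfold cornerValue
  split_ifs
  · exact h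
  · rw [mul_assoc]; exact mul_mem (D.crossUnit_mem _ _) h

/-- The `λ`-length of an arc, in terms of the cosets of the values of a potential. -/
theorem lam_eq (P : D.IsPotentialOn Set.univ R g) {a b : Fin n} (h : D.graph.Adj a b) :
    D.lam a b = (R b * (R a)⁻¹).val 0 1 ∨ D.lam a b = -(R b * (R a)⁻¹).val 0 1 := by
  have hs := P.side a trivial b trivial h
  have h1 : (g b a * (g a b)⁻¹).val = matE (D.lam a b) * (D.crossUnit a b).val := by
    rw [Units.val_mul, ← hs, mul_assoc, ← Units.val_mul, mul_inv_cancel, Units.val_one, mul_one]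
  -- The (1,2)-entry of $E(\lambda)$ is $-\lambda$, that of $E(\lambda)\rho$ is $\lambda$.
  have h2 : (g b a * (g a b)⁻¹).val 0 1 = D.lam a b ∨ (g b a * (g a b)⁻¹).val 0 1 = -D.lam a b := by
    rw [h1, crossUnit]
    split_ifs
    · simp [matE]
    · simp [matE, matRho, Matrix.mul_apply, Fin.sum_univ_three]
  have h3 := entry_eq_of_mem (P.coset b trivial a trivial h.symm) (P.coset a trivial b trivial h)
  rcases h2 with h2 | h2 <;> rcases h3 with h3 | h3 <;> rw [h2] at h3
  · exact Or.inl h3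
  · exact Or.inr h3
  · exact Or.inr (neg_eq_iff_eq_neg.mp h3)
  · exact Or.inl (neg_injective h3)

end SuperDecoration

/-! ### Performing flips and reducing crossings. -/

theorem Crosses.congr_left {n : ℕ} {a b a' b' c d : Fin n} (h : s(a, b) = s(a', b'))
    (hc : Crosses a b c d) : Crosses a' b' c d := by
  rcases Sym2.eq_iff.mp h with ⟨rfl, rfl⟩ | ⟨rfl, rfl⟩
  · exact hc
  · exact hc.swap_left

theorem Crosses.congr_right {n : ℕ} {a b c d c' d' : Fin n} (h : s(c, d) = s(c', d'))
    (hc : Crosses a b c d) : Crosses a b c' d' :=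
  (hc.symm.congr_left h).symm

/-- The flip of a diagonal in a triangulation. -/
theorem PolygonTriangulation.exists_diagonal_flip {n : ℕ} (T : PolygonTriangulation n) {i j k l : Fin n}
    (h₁ : Ccw i j k) (h₂ : Ccw i k l) (t₁ : T.IsTriangle i j k) (t₂ : T.IsTriangle i k l) :
    ∃ T' : PolygonTriangulation n, ∀ a b, T'.graph.Adj a b ↔
      (T.graph.Adj a b ∧ s(a, b) ≠ s(i, k)) ∨ s(a, b) = s(j, l) := by
  obtain ⟨h₃, h₄⟩ := h₁.rotate_quad h₂
  have hjl : j ≠ l := h₃.ne₁₃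
  have hik : Crosses i k j l := crosses_of_ccw h₁ h₂
  have hsides : ∀ a b, T.graph.Adj a b → s(a, b) ≠ s(i, k) → ¬ Crosses j l a b :=
    fun a b hab hne hcr => hne (eq_of_crosses h₁ h₂ t₁ t₂ hab hcr)
  refine ⟨⟨⟨fun a b => (T.graph.Adj a b ∧ s(a, b) ≠ s(i, k)) ∨ s(a, b) = s(j, l), ⟨?_⟩, ⟨?_⟩⟩,
    ?_, ?_⟩, fun _ _ => Iff.rfl⟩
  · intro a b h
    rwa [T.graph.adj_comm, Sym2.eq_swap]
  · rintro a (h | h)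
    · exact h.1.ne rfl
    · rcases Sym2.eq_iff.mp h with ⟨rfl, rfl⟩ | ⟨rfl, rfl⟩ <;> exact hjl rfl
  · rintro a b c d (hab | hab) (hcd | hcd) hcr
    · exact T.noncrossing _ _ _ _ hab.1 hcd.1 hcr
    · exact hsides a b hab.1 hab.2 (hcr.congr_right hcd).symm
    · exact hsides c d hcd.1 hcd.2 (hcr.congr_left hab)
    · exact ((hcr.congr_left hab).congr_right hcd).ne rfl
  · intro a b hab h
    by_cases hT : T.graph.Adj a b
    · by_cases hs : s(a, b) = s(i, k)
      · exact absurd (hik.congr_left hs.symm) (h j l (Or.inr rfl))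
      · exact Or.inl ⟨hT, hs⟩
    · right
      have : ∃ c d, T.graph.Adj c d ∧ Crosses a b c d := by
        by_contra! hno
        exact hT (T.maximal a b hab hno)
      obtain ⟨c, d, hcd, hcr⟩ := this
      have hs : s(c, d) = s(i, k) := by
        by_contra hs
        exact h c d (Or.inl ⟨hcd, hs⟩) hcr
      have key : ∀ x y, T.graph.Adj x y → s(x, y) ≠ s(i, k) → ¬ Crosses x y a b :=
        fun x y hxy hne hx => h x y (Or.inl ⟨hxy, hne⟩) hx.symm
      rw [← (Sym2.eq_swap : s(l, j) = s(j, l))]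
      have n₁ := h₁.ne₁₂
      have n₂ := h₁.ne₂₃
      have n₃ := h₂.ne₁₃
      have n₄ := h₂.ne₂₃
      exact eq_of_crosses_quad h₁ h₂.rotate (hcr.congr_right hs).symm
        (key _ _ t₂.2.1.symm (by simp [n₃.symm, n₄.symm]))
        (key _ _ t₁.1 (by simp [n₁.symm, n₂]))
        (key _ _ t₁.2.2 (by simp [n₁.symm, n₂]))
        (key _ _ t₂.2.2.symm (by simp [n₃.symm, n₄.symm]))

theorem PolygonTriangulation.IsTriangle.eq_or_of_quad {n : ℕ} {T : PolygonTriangulation n}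
    {i j k l x y z : Fin n} (t₁ : T.IsTriangle i j l) (t₂ : T.IsTriangle j k l) (h₁ : Ccw i j l)
    (h₂ : Ccw j k l) (t : T.IsTriangle x y z) (h : s(x, y) = s(j, l)) : z = i ∨ z = k := by
  have key : T.IsTriangle j l z → z = i ∨ z = k := fun t => by
    rcases t.ccw_or with h | h
    · exact Or.inl (t.unique t₁.rotate h h₁.rotate)
    · exact Or.inr (t.swap.unique t₂.rotate.rotate h.rotate.rotate h₂.rotate.rotate)
  rcases Sym2.eq_iff.mp h with ⟨rfl, rfl⟩ | ⟨rfl, rfl⟩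
  · exact key t
  · exact key t.swap

namespace SuperDecoration

variable {K : Type*} [Field K] [LinearOrder K] {V : Type*} [AddCommGroup V] [Module K V] {n : ℕ}

open Classical in
/-- The arcs of a decorated triangulation that cross `ij`. -/
noncomputable def crossingArcs (D : SuperDecoration K V n) (i j : Fin n) :
    Finset (Fin n × Fin n) :=
  {p | D.graph.Adj p.1 p.2 ∧ Crosses i j p.1 p.2}

/-- The new diagonal ends at $i$ and cannot cross $ij$, whereas the removed one did. -/
theorem IsFlip.card_crossingArcs_lt {D D' : SuperDecoration K V n} {a b c d i j : Fin n}
    (F : D.IsFlip D' a b c d) (h : Crosses i j a c) (hi : i = b ∨ i = d) :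
    (D'.crossingArcs i j).card < (D.crossingArcs i j).card := by
  refine Finset.card_lt_card ((Finset.ssubset_iff_of_subset ?_).mpr ⟨(a, c), ?_, ?_⟩)
  · rintro ⟨x, y⟩ hp
    simp only [crossingArcs, Finset.mem_filter, Finset.mem_univ, true_and] at hp ⊢
    refine ⟨F.adj_old hp.1 fun hs => ?_, hp.2⟩
    have := hp.2.congr_right hs
    rcases hi with rfl | rfl
    · exact this.ne rfl
    · exact this.swap_right.ne rfl
  · simpa [crossingArcs] using ⟨F.triangle_left.2.1, h⟩
  · simp only [crossingArcs, Finset.mem_filter, Finset.mem_univ, true_and, not_and]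
    intro hac
    exfalso
    obtain ⟨n1, n2, n3, n4, n5, n6⟩ := F.ne_all
    rcases (F.adj_iff a c).mp hac with h | h
    · exact h.2 rfl
    · rcases Sym2.eq_iff.mp h with h | h
      · exact n1 h.1
      · exact n3 h.1

variable [IsStrictOrderedRing K]

/-- The term with two odd factors is even with zero body. -/
theorem flip_lam_pos (hK : ∀ x : K, 0 ≤ x → IsSquare x) (D : SuperDecoration K V n)
    {i j k l : Fin n} (t₁ : D.IsTriangle i j k) (t₂ : D.IsTriangle i k l) :
    IsPos (Ring.inverse (D.lam i k) * (D.lam i l * D.lam j k + D.lam k l * D.lam i j +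
      superSqrt (D.lam i l * D.lam k l * D.lam j k * D.lam i j) * D.mu i j k * D.mu i k l)) := by
  have pa := D.lam_pos _ _ t₂.2.1
  have pb := D.lam_pos _ _ t₂.2.2
  have pc := D.lam_pos _ _ t₁.2.2
  have pd := D.lam_pos _ _ t₁.1
  have ps := (superSqrt_spec hK (((pa.mul pb).mul pc).mul pd)).1
  have pn := (pa.mul pc).add (pb.mul pd)
  refine (D.lam_pos _ _ t₁.2.1).inverse.mul ⟨pn.1.add ?_, ?_⟩
  · exact (ps.1.mul_odd (D.mu_odd _ _ _ t₁)).mul (D.mu_odd _ _ _ t₂)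
  · rw [body_add, body_mul _ (D.mu i k l), (D.mu_odd _ _ _ t₂).body_eq_zero, mul_zero, add_zero]
    exact pn.2

theorem flip_mu_odd (hK : ∀ x : K, 0 ≤ x → IsSquare x) {σ θ a b c d : ExteriorAlgebra K V}
    (hσ : IsOdd σ) (hθ : IsOdd θ) (ha : IsPos a) (hb : IsPos b) (hc : IsPos c) (hd : IsPos d) :
    IsOdd ((σ * superSqrt (b * d) + θ * superSqrt (a * c)) *
      Ring.inverse (superSqrt (a * c + b * d))) := by
  have h1 := (superSqrt_spec hK (hb.mul hd)).1.1
  have h2 := (superSqrt_spec hK (ha.mul hc)).1.1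
  have h3 := (superSqrt_spec hK ((ha.mul hc).add (hb.mul hd))).1.inverse.1
  rw [← (h3.commute _).eq, ← (h1.commute σ).eq, ← (h2.commute θ).eq]
  exact h3.mul_odd ((h1.mul_odd hσ).add (h2.mul_odd hθ))

/-- Every diagonal can be flipped. -/
theorem exists_flip (hK : ∀ x : K, 0 ≤ x → IsSquare x) (D : SuperDecoration K V n)
    {i j k l : Fin n} (h₁ : Ccw i j k) (h₂ : Ccw i k l) (t₁ : D.IsTriangle i j k)
    (t₂ : D.IsTriangle i k l) (ho : D.orient i k) : ∃ D', D.IsFlip D' i j k l := by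
  classical
  obtain ⟨T', hT'⟩ := D.exists_diagonal_flip h₁ h₂ t₁ t₂
  obtain ⟨h₃, h₄⟩ := h₁.rotate_quad h₂
  have n₁ := h₁.ne₁₂
  have n₂ := h₁.ne₂₃
  have n₃ := h₂.ne₁₃
  have n₄ := h₂.ne₂₃
  have n₅ := h₁.ne₁₃
  have n₆ := h₃.ne₁₃
  have ajl : T'.graph.Adj j l := (hT' _ _).mpr (Or.inr rfl)
  have tL : T'.IsTriangle i j l :=
    ⟨(hT' _ _).mpr (Or.inl ⟨t₁.1, by simp [n₁.symm, n₂]⟩),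
      (hT' _ _).mpr (Or.inl ⟨t₂.2.1, by simp [n₃.symm, n₄.symm]⟩), ajl⟩
  have tR : T'.IsTriangle j k l :=
    ⟨(hT' _ _).mpr (Or.inl ⟨t₁.2.2, by simp [n₁.symm, n₂]⟩), ajl,
      (hT' _ _).mpr (Or.inl ⟨t₂.2.2, by simp [n₃.symm, n₄.symm, n₅.symm]⟩)⟩
  have old : ∀ {a b}, T'.graph.Adj a b → s(a, b) ≠ s(j, l) → D.graph.Adj a b :=
    fun h h' => (((hT' _ _).mp h).resolve_right h').1
  have special : ∀ {a b c}, T'.IsTriangle a b c → s(a, b) = s(j, l) →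
      ({a, b, c} : Finset (Fin n)) = {j, k, l} ∨ ({a, b, c} : Finset (Fin n)) = {i, j, l} := by
    intro a b c t h
    rcases tL.eq_or_of_quad tR h₄.rotate h₃ t h with rfl | rfl <;>
      rcases Sym2.eq_iff.mp h with ⟨rfl, rfl⟩ | ⟨rfl, rfl⟩
    · right; ext; simp; tauto
    · right; ext; simp; tauto
    · left; ext; simp; tauto
    · left; ext; simp; tauto
  have rot : ∀ a b c : Fin n, ({a, b, c} : Finset (Fin n)) = {b, c, a} := by
    intro a b c; ext; simp; tauto
  have swp : ∀ a b c : Fin n, ({a, b, c} : Finset (Fin n)) = {b, a, c} := by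
    intro a b c; ext; simp; tauto
  have swr : ∀ a b c : Fin n, ({a, b, c} : Finset (Fin n)) = {a, c, b} := by
    intro a b c; ext; simp; tauto
  have oldT : ∀ {a b c}, T'.IsTriangle a b c → ({a, b, c} : Finset (Fin n)) ≠ {j, k, l} →
      ({a, b, c} : Finset (Fin n)) ≠ {i, j, l} → D.IsTriangle a b c := by
    intro a b c t h h'
    refine ⟨old t.1 fun hs => (special t hs).elim h h', old t.2.1 fun hs => ?_,
      old t.2.2 fun hs => ?_⟩
    · have := special t.swap_right hs
      rw [← swr] at this
      exact this.elim h h'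
    · have := special t.rotate hs
      rw [← rot] at this
      exact this.elim h h'
  have hne : ({i, j, l} : Finset (Fin n)) ≠ {j, k, l} := fun h => by
    have : i ∈ ({j, k, l} : Finset (Fin n)) := h ▸ by simp
    simp [n₁, n₃, n₅] at this
  obtain ⟨f, hf⟩ : ∃ f, f = Ring.inverse (D.lam i k) *
      (D.lam i l * D.lam j k + D.lam k l * D.lam i j +
      superSqrt (D.lam i l * D.lam k l * D.lam j k * D.lam i j) * D.mu i j k * D.mu i k l) :=
    ⟨_, rfl⟩
  have fpos : IsPos f := hf ▸ D.flip_lam_pos hK t₁ t₂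
  have pa := D.lam_pos _ _ t₂.2.1
  have pb := D.lam_pos _ _ t₂.2.2
  have pc := D.lam_pos _ _ t₁.2.2
  have pd := D.lam_pos _ _ t₁.1
  obtain ⟨μR, hμR⟩ : ∃ μR, μR = (D.mu i j k * superSqrt (D.lam k l * D.lam i j) -
      D.mu i k l * superSqrt (D.lam i l * D.lam j k)) *
      Ring.inverse (superSqrt (D.lam i l * D.lam j k + D.lam k l * D.lam i j)) := ⟨_, rfl⟩
  obtain ⟨μL, hμL⟩ : ∃ μL, μL = (D.mu i k l * superSqrt (D.lam k l * D.lam i j) +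
      D.mu i j k * superSqrt (D.lam i l * D.lam j k)) *
      Ring.inverse (superSqrt (D.lam i l * D.lam j k + D.lam k l * D.lam i j)) := ⟨_, rfl⟩
  have oddR : IsOdd μR := by
    have := flip_mu_odd hK (D.mu_odd _ _ _ t₁) (D.mu_odd _ _ _ t₂).neg pa pb pc pd
    rwa [neg_mul, ← sub_eq_add_neg, ← hμR] at this
  have oddL : IsOdd μL := by
    have := flip_mu_odd hK (D.mu_odd _ _ _ t₂) (D.mu_odd _ _ _ t₁) pa pb pc pd
    rwa [← hμL] at this
  let D' : SuperDecoration K V n :=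
    { toPolygonTriangulation := T'
      orient := fun a b => if a = j ∧ b = l then True else if a = l ∧ b = j then False else
        if s(a, b) = s(k, l) then D.orient b a else D.orient a b
      orient_xor := by
        intro a b hab
        by_cases hs : s(a, b) = s(j, l)
        · rcases Sym2.eq_iff.mp hs with ⟨rfl, rfl⟩ | ⟨rfl, rfl⟩
          · simp [n₆.symm]
          · simp [n₆.symm]
        · have hD := D.orient_xor a b (old hab hs)
          rw [Sym2.eq_iff, not_or] at hs
          have h1 : ¬ (b = j ∧ a = l) := fun h => hs.2 h.symm
          have h2 : ¬ (b = l ∧ a = j) := fun h => hs.1 h.symm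
          simp only [if_neg hs.1, if_neg hs.2, if_neg h1, if_neg h2]
          rw [(Sym2.eq_swap : s(b, a) = s(a, b))]
          split_ifs
          · rwa [xor_comm]
          · exact hD
      lam := fun a b => if s(a, b) = s(j, l) then f else D.lam a b
      lam_symm := by
        intro a b hab
        by_cases hs : s(a, b) = s(j, l)
        · rw [if_pos hs, if_pos (Sym2.eq_swap.trans hs)]
        · rw [if_neg hs, if_neg fun h => hs (Sym2.eq_swap.trans h), D.lam_symm _ _ (old hab hs)]
      lam_pos := by
        intro a b hab
        by_cases hs : s(a, b) = s(j, l)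
        · rwa [if_pos hs]
        · rw [if_neg hs]; exact D.lam_pos _ _ (old hab hs)
      -- Testing the unordered vertex set makes the new values symmetric.
      mu := fun a b c => if ({a, b, c} : Finset (Fin n)) = {j, k, l} then μR else
        if ({a, b, c} : Finset (Fin n)) = {i, j, l} then μL else D.mu a b c
      mu_swap := by
        intro a b c t
        rw [swp b a c]
        split_ifs with h h'
        · rfl
        · rfl
        · exact D.mu_swap _ _ _ (oldT t h h')
      mu_rotate := by
        intro a b c t
        rw [← rot a b c]
        split_ifs with h h'
        · rfl
        · rfl
        · exact D.mu_rotate _ _ _ (oldT t h h')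
      mu_odd := by
        intro a b c t
        split_ifs with h h'
        · exact oddR
        · exact oddL
        · exact D.mu_odd _ _ _ (oldT t h h') }
  refine ⟨D', ⟨h₁, h₂, t₁, t₂, ho, hT', ?_, ?_, ?_, ?_, ?_, ?_, ?_, ?_⟩⟩
  · simp [D']
  · simp [D', n₂.symm, n₄]
  · intro a b _ h h'
    rw [ne_eq, Sym2.eq_iff, not_or] at h
    simp only [D', if_neg h.1, if_neg h.2, if_neg h']
  · intro a b _ h
    exact if_neg h
  · change D.lam i k * (if s(j, l) = s(j, l) then f else D.lam j l) = _
    rw [if_pos rfl, hf, ← mul_assoc, Ring.mul_inverse_cancel _ (D.lam_pos _ _ t₁.2.1).isUnit,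
      one_mul]
  · intro a b c _ h1 h2 h3
    have hno : ¬ (j ∈ ({a, b, c} : Finset (Fin n)) ∧ l ∈ ({a, b, c} : Finset (Fin n))) := by
      rintro ⟨hj, hl⟩
      simp only [Finset.mem_insert, Finset.mem_singleton] at hj hl
      simp only [ne_eq, Sym2.eq_iff, not_or] at h1 h2 h3
      rcases hj with rfl | rfl | rfl <;> rcases hl with rfl | rfl | rfl <;>
        first | exact n₆ rfl | simp_all
    change (if _ then μR else if _ then μL else D.mu a b c) = _
    rw [if_neg, if_neg]
    · exact fun h => hno (by rw [h]; simp)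
    · exact fun h => hno (by rw [h]; simp)
  · rw [← hμR]
    exact if_pos rfl
  · rw [← hμL]
    change (if _ then μR else if _ then μL else D.mu i j l) = _
    rw [if_neg hne, if_pos rfl]

/-- An arc that is missing from the triangulation is crossed by a diagonal whose flip yields an
arc with endpoint `i`. -/
theorem exists_flip_card_lt (hK : ∀ x : K, 0 ≤ x → IsSquare x) (D : SuperDecoration K V n)
    {i j : Fin n} (hij : i ≠ j) (h : ¬ D.graph.Adj i j) :
    ∃ D' a b c d, D.IsFlip D' a b c d ∧ (D'.crossingArcs i j).card < (D.crossingArcs i j).card := by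
  obtain ⟨x, hx⟩ : ∃ x, Ccw i x j := by
    by_contra! hno
    exact h (D.adj_of_not_ccw hij hno)
  -- With `a` the last neighbour of `i` before `j`, the triangle on $ia$ towards `j` has its third
  -- vertex `b` beyond `j`. Its side $ab$ then crosses $ij$, and flipping it gives an arc at `i`.
  obtain ⟨a, ha, ia, hmax⟩ := D.exists_last_neighbour hx
  obtain ⟨b, hb, ab, bi⟩ := D.exists_triangle ia.symm ha.rotate
  have hbj : b ≠ j := by rintro rfl; exact h bi.symm
  have hb' : Ccw i j b := by
    refine (ccw_or_ccw bi.ne' hij hbj).resolve_left fun hb' => ?_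
    exact hmax b hb' bi.symm hb.rotate.rotate
  have hab : Ccw a j b := by
    simp only [Ccw, Fin.lt_def] at ha hb' ⊢; omega
  obtain ⟨c, hc, ac, cb⟩ := D.exists_triangle ab hab
  have t₁ : D.IsTriangle a c b := ⟨ac, ab, cb⟩
  have t₂ : D.IsTriangle a b i := ⟨ab, ia.symm, bi⟩
  have hcr : Crosses i j a b := Or.inl ⟨ha, hb'.rotate⟩
  -- The two orientations read the same quadrilateral from opposite corners.
  rcases D.orient_xor a b ab with ⟨ho, -⟩ | ⟨ho, -⟩
  · obtain ⟨D', F⟩ := D.exists_flip hK hc hb t₁ t₂ ho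
    exact ⟨D', _, _, _, _, F, F.card_crossingArcs_lt hcr (Or.inr rfl)⟩
  · obtain ⟨D', F⟩ := D.exists_flip hK hb.rotate hc.rotate.rotate t₂.rotate
      t₁.rotate.rotate ho
    exact ⟨D', _, _, _, _, F, F.card_crossingArcs_lt hcr.swap_right (Or.inl rfl)⟩

/-- Every arc appears after a suitable sequence of flips. -/
theorem exists_flips (hK : ∀ x : K, 0 ≤ x → IsSquare x) {i j : Fin n} (hij : i ≠ j) (m : ℕ) :
    ∀ D : SuperDecoration K V n, (D.crossingArcs i j).card ≤ m → ∃ D' : SuperDecoration K V n,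
      Relation.ReflTransGen (fun D₁ D₂ => ∃ a b c d, IsFlip D₁ D₂ a b c d) D D' ∧
        D'.graph.Adj i j := by
  induction m with
  | zero =>
    intro D hD
    by_cases h : D.graph.Adj i j
    · exact ⟨D, .refl, h⟩
    · obtain ⟨D', a, b, c, d, F, hlt⟩ := D.exists_flip_card_lt hK hij h
      omega
  | succ m ih =>
    intro D hD
    by_cases h : D.graph.Adj i j
    · exact ⟨D, .refl, h⟩
    · obtain ⟨D₁, a, b, c, d, F, hlt⟩ := D.exists_flip_card_lt hK hij h
      obtain ⟨D', h₁, h₂⟩ := ih D₁ (by omega)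
      exact ⟨D', .head ⟨a, b, c, d, F⟩ h₁, h₂⟩

theorem exists_potential_of_flips (hK : ∀ x : K, 0 ≤ x → IsSquare x)
    {D D' : SuperDecoration K V n} {R : Fin n → (GMat K V)ˣ}
    (h : Relation.ReflTransGen (fun D₁ D₂ => ∃ a b c d, IsFlip D₁ D₂ a b c d) D D')
    (hD : ∃ g, D.IsPotentialOn Set.univ R g) : ∃ g, D'.IsPotentialOn Set.univ R g := by
  induction h with
  | refl => exact hD
  | tail _ h ih =>
    obtain ⟨a, b, c, d, F⟩ := h
    obtain ⟨g, P⟩ := ih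
    exact F.exists_potential hK P

end SuperDecoration

theorem theorem3p10 {K : Type*} [Field K] [LinearOrder K] [IsStrictOrderedRing K]
    (hK : ∀ x : K, 0 ≤ x → IsSquare x) {V : Type*} [AddCommGroup V] [Module K V] {n : ℕ}
    (D : SuperDecoration K V n) (i j : Fin n)
    (i' j' : GammaVertex D.toPolygonTriangulation) (hi : i'.near = i) (hj : j'.near = j) :
    ∃ (H : Matrix (Fin 3) (Fin 3) (ExteriorAlgebra K V)) (ℓ : ExteriorAlgebra K V),
      Nonempty ((gammaGraph D.toPolygonTriangulation).Walk i' j') ∧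
      (∀ p : (gammaGraph D.toPolygonTriangulation).Walk i' j', D.holonomy p = H) ∧
      D.IsLambdaLength i j ℓ ∧
      (∀ x, D.IsLambdaLength i j x → x = ℓ) ∧
      (H 0 1 = ℓ ∨ H 0 1 = -ℓ) := by
  obtain ⟨R, g, P⟩ := D.exists_potential hK
  have hH : _ = (R j * (R i)⁻¹).val 0 1 ∨ _ = -(R j * (R i)⁻¹).val 0 1 :=
    entry_eq_of_mem (hj ▸ D.cornerValue_coset P j') (hi ▸ D.cornerValue_coset P i')
  have hwalk := GammaVertex.reachable i' j'
  by_cases hij : i = j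
  · subst hij
    refine ⟨_, 0, hwalk, SuperDecoration.holonomy_eq hK P, Or.inl ⟨rfl, rfl⟩, ?_, ?_⟩
    · rintro x (⟨-, hx⟩ | ⟨D', -, h, -⟩)
      · exact hx
      · exact absurd rfl h.ne
    -- Here $R_iR_i^{-1}=1$, whose (1,2)-entry vanishes.
    · simpa using hH
  · have hlam : ∀ x, D.IsLambdaLength i j x → IsPos x ∧
        (x = (R j * (R i)⁻¹).val 0 1 ∨ x = -(R j * (R i)⁻¹).val 0 1) := by
      rintro x (⟨h, -⟩ | ⟨D', h, hadj, rfl⟩)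
      · exact absurd h hij
      · obtain ⟨g', P'⟩ := SuperDecoration.exists_potential_of_flips hK h ⟨g, P⟩
        exact ⟨D'.lam_pos _ _ hadj, SuperDecoration.lam_eq P' hadj⟩
    obtain ⟨D', h, hadj⟩ := SuperDecoration.exists_flips hK hij _ D le_rfl
    have hℓ : D.IsLambdaLength i j (D'.lam i j) := Or.inr ⟨D', h, hadj, rfl⟩
    obtain ⟨hpos, hval⟩ := hlam _ hℓ
    refine ⟨_, D'.lam i j, hwalk, SuperDecoration.holonomy_eq hK P, hℓ, fun x hx => ?_, ?_⟩
    · obtain ⟨hxpos, hxval⟩ := hlam x hx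
      refine hxpos.eq_of_eq_or_eq_neg hpos ?_
      rcases hxval with h1 | h1 <;> rcases hval with h2 | h2 <;> rw [h1, h2] <;> simp
    · rcases hH with h1 | h1 <;> rcases hval with h2 | h2 <;> rw [h1, h2] <;> simp
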